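/- Let $T>0$ and $H\in(\tfrac12,1)$, let $W=(W_t)_{t\in[0,T]}$ be a standard Brownian motion and $B^H=(B^H_t)_{t\in[0,T]}$ a fractional Brownian motion with Hurst parameter $H$ (a centred Gaussian process with almost surely continuous paths and covariance $\tfrac12(s^{2H}+t^{2H}-|t-s|^{2H})$), independent of $W$, on a common probability space $(\Omega,\mathcal F,\mathbb P)$, and put $X_t=W_t+B^H_t$. For a $C^1$ function $f:\mathbb R\to\mathbb C$ and $t\in[0,T]$ let $\int_0^t f(s)\,dX_s:=f(t)X_t-f(0)X_0-\int_0^t X_s f'(s)\,ds$ (path by path; $X_0=0$ a.s.), and for $\lambda\in\mathbb R$ let $$I_T(X;\lambda)=\Big|\int_0^T e^{i\lambda s}\,dX_s\Big|^2 .$$ For partitions $\pi=\{0=t_0<t_1<\dots<t_n=T\}$ write $|\pi|=\max_i(t_i-t_{i-1})$. Then the quadratic variation $$[X]_T=\lim_{|\pi|\to0}\sum_{i=1}^n(X_{t_i}-X_{t_{i-1}})^2$$ exists as a limit in probability, and there are functions $J_\lambda:\Omega\to\mathbb C$, denoted $J_\lambda=\int_0^T\int_0^t e^{i\lambda(t-s)}\,dX_s\,dX_t$,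 $\lambda\in\mathbb R$, that are pathwise limits of Riemann–Stieltjes sums in the following sense: for every nested sequence of partitions $(\pi_k)$ of $[0,T]$ with $|\pi_k|\to0$, almost surely $$\sum_{t_i\in\pi_k,\,i\ge1}(X_{t_i}-X_{t_{i-1}})^2\to[X]_T\quad\text{and, for all }\lambda\in\mathbb R,\quad \sum_{t_i\in\pi_k,\,i\ge1}\Big(\int_0^{t_{i-1}}e^{i\lambda(t_{i-1}-s)}\,dX_s\Big)(X_{t_i}-X_{t_{i-1}})\to J_\lambda .$$ Moreover, almost surely, for all $\lambda\in\mathbb R$, $$I_T(X;\lambda)=[X]_T+2\,\mathrm{Re}\int_0^T\int_0^t e^{i\lambda(t-s)}\,dX_s\,dX_t .$$ -/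

import Mathlib

open MeasureTheory ProbabilityTheory Filter Topology

noncomputable section

namespace MixedFBM

variable {Ω : Type*} [MeasurableSpace Ω]

/-- `W` is a standard Brownian motion on the time interval `[0, T]` under `P`. Only the values
`W t` with `t ∈ [0, T]` matter. -/
structure IsBrownianOn (W : ℝ → Ω → ℝ) (T : ℝ) (P : Measure Ω) : Prop where
  zero : ∀ᵐ ω ∂P, W 0 ω = 0
  indep_increments : HasIndepIncrements (fun t : Set.Icc (0 : ℝ) T => W t) P
  law_increments : ∀ s t : ℝ, 0 ≤ s → s ≤ t → t ≤ T →
    HasLaw (fun ω => W t ω - W s ω) (gaussianReal 0 (t - s).toNNReal) P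
  cont : ∀ᵐ ω ∂P, ContinuousOn (fun t => W t ω) (Set.Icc 0 T)

/-- `B` is a fractional Brownian motion with Hurst parameter `H` on `[0, T]` under `P`: a centred
Gaussian process with the fractional covariance and almost surely continuous paths. -/
structure IsFractionalBrownianOn (B : ℝ → Ω → ℝ) (H T : ℝ) (P : Measure Ω) : Prop where
  gaussian : IsGaussianProcess (fun t : Set.Icc (0 : ℝ) T => B t) P
  mean : ∀ t ∈ Set.Icc (0 : ℝ) T, ∫ ω, B t ω ∂P = 0
  covariance : ∀ s ∈ Set.Icc (0 : ℝ) T, ∀ t ∈ Set.Icc (0 : ℝ) T,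
    cov[B s, B t; P] = (s ^ (2 * H) + t ^ (2 * H) - |t - s| ^ (2 * H)) / 2
  cont : ∀ᵐ ω ∂P, ContinuousOn (fun t => B t ω) (Set.Icc 0 T)

/-- A finite partition `0 = t 0 < t 1 < ⋯ < t n = T`. The values `t i` with `i > n` are
irrelevant. -/
structure TimePartition (T : ℝ) where
  n : ℕ
  t : ℕ → ℝ
  t_zero : t 0 = 0
  t_last : t n = T
  t_lt : ∀ i < n, t i < t (i + 1)

namespace TimePartition

variable {T : ℝ}

/-- The set of partition points. -/
def points (π : TimePartition T) : Set ℝ := π.t '' Set.Iic π.n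

/-- The mesh `max_i (t (i+1) - t i)`. -/
def mesh (π : TimePartition T) : ℝ := ⨆ i : Fin π.n, (π.t (i + 1) - π.t i)

/-- The filter `|π| → 0` on partitions. -/
def meshToZero (T : ℝ) : Filter (TimePartition T) := comap mesh (𝓝 0)

/-- A nested sequence of partitions whose mesh tends to zero. -/
structure IsNestedSeq (ρ : ℕ → TimePartition T) : Prop where
  nested : ∀ k, (ρ k).points ⊆ (ρ (k + 1)).points
  mesh_tendsto : Tendsto (fun k => (ρ k).mesh) atTop (𝓝 0)

end TimePartition

/-- The realized quadratic variation of the path `x` along `π`. -/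
def quadSum {T : ℝ} (x : ℝ → ℝ) (π : TimePartition T) : ℝ :=
  ∑ i ∈ Finset.range π.n, (x (π.t (i + 1)) - x (π.t i)) ^ 2

/-- `V` is the quadratic variation of `X` at time `T`: the limit in probability of the realized
quadratic variations as the mesh of the partition of `[0, T]` tends to zero. -/
def IsQuadraticVariation (X : ℝ → Ω → ℝ) (T : ℝ) (P : Measure Ω) (V : Ω → ℝ) : Prop :=
  TendstoInMeasure P (fun (π : TimePartition T) ω => quadSum (fun t => X t ω) π)
    (TimePartition.meshToZero T) V

/-- The pathwise integral `∫_0^t f(s) dx(s)` of a smooth function `f` against a continuous path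
`x`, defined by integration by parts. -/
def pathIntegral (f : ℝ → ℂ) (x : ℝ → ℝ) (t : ℝ) : ℂ :=
  f t * x t - f 0 * x 0 - ∫ s in (0 : ℝ)..t, (x s : ℂ) * deriv f s

/-- The periodogram `|∫_0^T e^{iλs} dx(s)|²`. -/
def periodogram (x : ℝ → ℝ) (T lam : ℝ) : ℝ :=
  ‖pathIntegral (fun s => Complex.exp (Complex.I * lam * s)) x T‖ ^ 2

/-- The Riemann–Stieltjes sum along `π` (integrand evaluated at left endpoints) of the iterated
integral `∫_0^T (∫_0^t e^{iλ(t-s)} dx(s)) dx(t)`. -/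
def iteratedSum {T : ℝ} (x : ℝ → ℝ) (lam : ℝ) (π : TimePartition T) : ℂ :=
  ∑ i ∈ Finset.range π.n,
    pathIntegral (fun s => Complex.exp (Complex.I * lam * (π.t i - s))) x (π.t i) *
      ((x (π.t (i + 1)) - x (π.t i) : ℝ) : ℂ)

end MixedFBM

end

/-!
The quadratic variation is `V = T`. Everything else is pathwise: `∫_0^t e^{iλ(t-s)} dx(s)` is `x t`
plus a `C¹` function of `t`. Left Riemann sums of the `C¹` part against `dx` converge for any
continuous path `x`, after summation by parts, while those of `x dx` equal
`(x T ^ 2 - x 0 ^ 2 - quadSum x π) / 2` and so converge as soon as the sums of squares do, on the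
same null set for all `λ`. The periodogram identity follows by integrating the derivative of the
squared norm of the `C¹` part.

For the sums of squares, Kolmogorov–Chentsov makes the paths of the fractional Brownian motion
Hölder of an exponent above `1/2`, so their sums of squares vanish in the limit and, by
Cauchy–Schwarz, do not affect those of `W`. The sums of squares of `W` along a partition have mean
`T` and variance `O(mesh)`. Along a nested sequence they form a reverse martingale: they do not
change when the path is reflected between two of the partition points, and reflection invariance
makes increments over disjoint intervals orthogonal. The maximal inequality turns the variance bound
into almost sure convergence, with no rate imposed on the mesh.
-/

noncomputable section

open scoped NNReal ENNReal

namespace MixedFBM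

namespace TimePartition

variable {T : ℝ} (π : TimePartition T)

lemma t_lt_t {i j : ℕ} (hij : i < j) (hj : j ≤ π.n) : π.t i < π.t j := by
  induction j, hij using Nat.le_induction with
  | base => exact π.t_lt i hj
  | succ k _ ih => exact (ih (by omega)).trans (π.t_lt k hj)

lemma t_le_t {i j : ℕ} (hij : i ≤ j) (hj : j ≤ π.n) : π.t i ≤ π.t j := by
  rcases hij.eq_or_lt with rfl | h
  · exact le_rfl
  · exact (π.t_lt_t h hj).le

lemma le_of_t_le_t {i j : ℕ} (hi : i ≤ π.n) (h : π.t i ≤ π.t j) : i ≤ j :=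
  not_lt.1 fun hji => (π.t_lt_t hji hi).not_ge h

lemma t_mem_Icc {i : ℕ} (hi : i ≤ π.n) : π.t i ∈ Set.Icc 0 T :=
  ⟨π.t_zero.symm.trans_le (π.t_le_t i.zero_le hi), (π.t_le_t hi le_rfl).trans_eq π.t_last⟩

lemma t_mem_points {i : ℕ} (hi : i ≤ π.n) : π.t i ∈ π.points := ⟨i, hi, rfl⟩

lemma sub_le_mesh {i : ℕ} (hi : i < π.n) : π.t (i + 1) - π.t i ≤ π.mesh :=
  le_ciSup (f := fun i : Fin π.n => π.t (i + 1) - π.t i) (Set.finite_range _).bddAbove ⟨i, hi⟩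

lemma sum_sub : ∑ i ∈ Finset.range π.n, (π.t (i + 1) - π.t i) = T := by
  rw [Finset.sum_range_sub, π.t_last, π.t_zero, sub_zero]

lemma IsNestedSeq.points_mono {ρ : ℕ → TimePartition T} (hρ : IsNestedSeq ρ) :
    Monotone fun k => (ρ k).points :=
  monotone_nat_of_le_succ hρ.nested

end TimePartition

section QuadSum

variable {T : ℝ} {x y : ℝ → ℝ}

lemma quadSum_nonneg (x : ℝ → ℝ) (π : TimePartition T) : 0 ≤ quadSum x π :=
  Finset.sum_nonneg fun _ _ => sq_nonneg _

lemma quadSum_congr (h : Set.EqOn x y (Set.Icc 0 T)) (π : TimePartition T) :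
    quadSum x π = quadSum y π := by
  refine Finset.sum_congr rfl fun i hi => ?_
  have hi := Finset.mem_range.1 hi
  rw [h (π.t_mem_Icc hi.le), h (π.t_mem_Icc hi)]

lemma abs_quadSum_add_sub_le (x y : ℝ → ℝ) (π : TimePartition T) :
    |quadSum (fun t => x t + y t) π - quadSum x π| ≤
      2 * √(quadSum x π * quadSum y π) + quadSum y π := by
  set c := ∑ i ∈ Finset.range π.n,
    (x (π.t (i + 1)) - x (π.t i)) * (y (π.t (i + 1)) - y (π.t i))
  have hexpand : quadSum (fun t => x t + y t) π - quadSum x π = 2 * c + quadSum y π := by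
    simp only [c, quadSum, Finset.mul_sum, ← Finset.sum_sub_distrib, ← Finset.sum_add_distrib]
    exact Finset.sum_congr rfl fun i _ => by ring
  have hcauchy : |c| ≤ √(quadSum x π * quadSum y π) :=
    Real.abs_le_sqrt (Finset.sum_mul_sq_le_sq_mul_sq _ _ _)
  calc |quadSum (fun t => x t + y t) π - quadSum x π|
      ≤ |2 * c| + |quadSum y π| := hexpand ▸ abs_add_le _ _
    _ = 2 * |c| + quadSum y π := by
      rw [abs_mul, abs_two, abs_of_nonneg (quadSum_nonneg y π)]
    _ ≤ 2 * √(quadSum x π * quadSum y π) + quadSum y π := by gcongr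

lemma tendsto_quadSum_add {ι : Type*} {l : Filter ι} {π : ι → TimePartition T} {V : ℝ}
    (hx : Tendsto (fun k => quadSum x (π k)) l (𝓝 V))
    (hy : Tendsto (fun k => quadSum y (π k)) l (𝓝 0)) :
    Tendsto (fun k => quadSum (fun t => x t + y t) (π k)) l (𝓝 V) := by
  have hbound : Tendsto (fun k => 2 * √(quadSum x (π k) * quadSum y (π k)) + quadSum y (π k)) l
      (𝓝 0) := by
    simpa using ((Real.continuous_sqrt.tendsto _).comp (hx.mul hy)).const_mul 2 |>.add hy
  have hdiff : Tendsto (fun k => quadSum (fun t => x t + y t) (π k) - quadSum x (π k)) l (𝓝 0) :=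
    squeeze_zero_norm (fun k => abs_quadSum_add_sub_le x y (π k)) hbound
  simpa using hdiff.add hx

lemma quadSum_le_of_holderOnWith {C γ : ℝ≥0} (hγ : 1 / 2 ≤ γ)
    (hx : HolderOnWith C γ x (Set.Icc 0 T)) (π : TimePartition T) :
    quadSum x π ≤ C ^ 2 * π.mesh ^ (2 * (γ : ℝ) - 1) * T := by
  have hγ' : (1 / 2 : ℝ) ≤ γ := by exact_mod_cast hγ
  refine le_of_le_of_eq ?_ (congrArg _ π.sum_sub)
  rw [Finset.mul_sum]
  refine Finset.sum_le_sum fun i hi => ?_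
  have hi := Finset.mem_range.1 hi
  have hpos : 0 < π.t (i + 1) - π.t i := sub_pos.2 (π.t_lt i hi)
  have hdist := hx.dist_le (π.t_mem_Icc hi) (π.t_mem_Icc hi.le)
  rw [Real.dist_eq, Real.dist_eq, abs_of_pos hpos] at hdist
  have hsplit : ((π.t (i + 1) - π.t i) ^ (γ : ℝ)) ^ 2 =
      (π.t (i + 1) - π.t i) ^ (2 * (γ : ℝ) - 1) * (π.t (i + 1) - π.t i) := by
    rw [← Real.rpow_natCast, ← Real.rpow_mul hpos.le, ← Real.rpow_add_one hpos.ne']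
    congr 1
    push_cast
    ring
  calc (x (π.t (i + 1)) - x (π.t i)) ^ 2
      ≤ (C * (π.t (i + 1) - π.t i) ^ (γ : ℝ)) ^ 2 := sq_le_sq.2 (hdist.trans (le_abs_self _))
    _ = C ^ 2 * (π.t (i + 1) - π.t i) ^ (2 * (γ : ℝ) - 1) * (π.t (i + 1) - π.t i) := by
      rw [mul_pow, hsplit, mul_assoc]
    _ ≤ C ^ 2 * π.mesh ^ (2 * (γ : ℝ) - 1) * (π.t (i + 1) - π.t i) := by
      gcongr
      · linarith [hγ']
      · exact π.sub_le_mesh hi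

lemma tendsto_quadSum_of_holderOnWith {C γ : ℝ≥0} (hγ : 1 / 2 < γ)
    (hx : HolderOnWith C γ x (Set.Icc 0 T)) :
    Tendsto (quadSum x) (TimePartition.meshToZero T) (𝓝 0) := by
  have hγ' : 0 < 2 * (γ : ℝ) - 1 := by
    have : (1 / 2 : ℝ) < γ := by exact_mod_cast hγ
    linarith
  have hmesh : Tendsto (fun π : TimePartition T => (C : ℝ) ^ 2 * π.mesh ^ (2 * (γ : ℝ) - 1) * T)
      (TimePartition.meshToZero T) (𝓝 0) := by
    have hlim : Tendsto TimePartition.mesh (TimePartition.meshToZero T) (𝓝 0) := tendsto_comap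
    simpa [Real.zero_rpow hγ'.ne'] using
      ((hlim.rpow_const (Or.inr hγ'.le)).const_mul ((C : ℝ) ^ 2)).mul_const T
  exact squeeze_zero (quadSum_nonneg x) (quadSum_le_of_holderOnWith hγ.le hx) hmesh

end QuadSum

section Pathwise

variable {T : ℝ} {x y : ℝ → ℝ}

lemma pathIntegral_congr (h : Set.EqOn x y (Set.Icc 0 T)) (f : ℝ → ℂ) {t : ℝ}
    (ht : t ∈ Set.Icc 0 T) : pathIntegral f x t = pathIntegral f y t := by
  have hint : ∫ s in (0 : ℝ)..t, (x s : ℂ) * deriv f s =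
      ∫ s in (0 : ℝ)..t, (y s : ℂ) * deriv f s := by
    refine intervalIntegral.integral_congr fun s hs => ?_
    rw [Set.uIcc_of_le ht.1] at hs
    simp only [h ⟨hs.1, hs.2.trans ht.2⟩]
  simp only [pathIntegral, hint, h ht, h ⟨le_rfl, ht.1.trans ht.2⟩]

lemma pathIntegral_const_mul (c : ℂ) (f : ℝ → ℂ) (x : ℝ → ℝ) (t : ℝ) :
    pathIntegral (fun s => c * f s) x t = c * pathIntegral f x t := by
  simp only [pathIntegral, deriv_const_mul_field, mul_left_comm _ c,
    intervalIntegral.integral_const_mul]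
  ring

lemma pathIntegral_conj (f : ℝ → ℂ) (x : ℝ → ℝ) (t : ℝ) :
    pathIntegral (fun s => starRingEnd ℂ (f s)) x t = starRingEnd ℂ (pathIntegral f x t) := by
  have hderiv (s : ℝ) : deriv (fun s => starRingEnd ℂ (f s)) s = starRingEnd ℂ (deriv f s) :=
    deriv.star ..
  have hint (g : ℝ → ℂ) : starRingEnd ℂ (∫ s in (0 : ℝ)..t, g s) =
      ∫ s in (0 : ℝ)..t, starRingEnd ℂ (g s) := by
    simp only [intervalIntegral, map_sub, integral_conj]
  simp only [pathIntegral, hderiv, hint, map_sub, map_mul, Complex.conj_ofReal]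

lemma quadSum_eq_sub_two_mul_sum (x : ℝ → ℝ) (π : TimePartition T) :
    quadSum x π = x T ^ 2 - x 0 ^ 2 -
      2 * ∑ i ∈ Finset.range π.n, x (π.t i) * (x (π.t (i + 1)) - x (π.t i)) := by
  have htel := Finset.sum_range_sub (fun i => x (π.t i) ^ 2) π.n
  rw [π.t_last, π.t_zero] at htel
  rw [← htel, quadSum, Finset.mul_sum, ← Finset.sum_sub_distrib]
  exact Finset.sum_congr rfl fun i _ => by ring

end Pathwise

section RiemannStieltjes

variable {T : ℝ} {x : ℝ → ℝ} {E : Type*} [NormedAddCommGroup E] [NormedSpace ℝ E]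

lemma sum_sub_smul_eq (x : ℝ → ℝ) (A : ℝ → E) (π : TimePartition T) :
    ∑ i ∈ Finset.range π.n, (x (π.t (i + 1)) - x (π.t i)) • A (π.t i) =
      x T • A T - x 0 • A 0 -
        ∑ i ∈ Finset.range π.n, x (π.t (i + 1)) • (A (π.t (i + 1)) - A (π.t i)) := by
  have htel := Finset.sum_range_sub (fun i => x (π.t i) • A (π.t i)) π.n
  rw [π.t_last, π.t_zero] at htel
  rw [← htel, ← Finset.sum_sub_distrib]
  refine Finset.sum_congr rfl fun i _ => ?_
  module

variable [CompleteSpace E] {A A' : ℝ → E}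

lemma norm_integral_smul_deriv_sub_le (hx : Continuous x) (hA : ∀ t, HasDerivAt A (A' t) t)
    (hA' : Continuous A') {a b δ C : ℝ} (hab : a ≤ b) (hδ : ∀ s ∈ Set.Ioc a b, |x s - x b| ≤ δ)
    (hC : ∀ s ∈ Set.Ioc a b, ‖A' s‖ ≤ C) :
    ‖(∫ s in a..b, x s • A' s) - x b • (A b - A a)‖ ≤ δ * C * (b - a) := by
  have hxA : Continuous fun s => x s • A' s := hx.smul hA'
  have hbA : Continuous fun s => x b • A' s := hA'.const_smul (x b)
  rw [← intervalIntegral.integral_eq_sub_of_hasDerivAt (fun t _ => hA t)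
    (hA'.intervalIntegrable a b), ← intervalIntegral.integral_smul,
    ← intervalIntegral.integral_sub (hxA.intervalIntegrable a b)
      (hbA.intervalIntegrable a b)]
  refine (intervalIntegral.norm_integral_le_of_norm_le_const fun s hs => ?_).trans_eq
    (by rw [abs_of_nonneg (sub_nonneg.2 hab)])
  rw [Set.uIoc_of_le hab] at hs
  rw [← sub_smul, norm_smul, Real.norm_eq_abs]
  exact mul_le_mul (hδ s hs) (hC s hs) (norm_nonneg _) ((abs_nonneg _).trans (hδ s hs))

lemma norm_integral_sub_sum_le (hx : Continuous x) (hA : ∀ t, HasDerivAt A (A' t) t)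
    (hA' : Continuous A') (π : TimePartition T) {δ C : ℝ}
    (hδ : ∀ s ∈ Set.Icc 0 T, ∀ t ∈ Set.Icc 0 T, |s - t| ≤ π.mesh → |x s - x t| ≤ δ)
    (hC : ∀ s ∈ Set.Icc 0 T, ‖A' s‖ ≤ C) :
    ‖(∫ s in (0 : ℝ)..T, x s • A' s) -
      ∑ i ∈ Finset.range π.n, x (π.t (i + 1)) • (A (π.t (i + 1)) - A (π.t i))‖ ≤ δ * C * T := by
  have hxA : Continuous fun s => x s • A' s := hx.smul hA'
  have hint : ∫ s in (0 : ℝ)..T, x s • A' s =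
      ∑ i ∈ Finset.range π.n, ∫ s in (π.t i)..(π.t (i + 1)), x s • A' s := by
    rw [intervalIntegral.sum_integral_adjacent_intervals
      fun i _ => hxA.intervalIntegrable _ _, π.t_zero, π.t_last]
  refine le_of_le_of_eq ?_ (congrArg _ π.sum_sub)
  rw [hint, ← Finset.sum_sub_distrib, Finset.mul_sum]
  refine norm_sum_le_of_le _ fun i hi => ?_
  have hi := Finset.mem_range.1 hi
  have hmem : ∀ s ∈ Set.Ioc (π.t i) (π.t (i + 1)), s ∈ Set.Icc 0 T := fun s hs =>
    ⟨(π.t_mem_Icc hi.le).1.trans hs.1.le, hs.2.trans (π.t_mem_Icc hi).2⟩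
  refine norm_integral_smul_deriv_sub_le hx hA hA' (π.t_lt i hi).le (fun s hs => ?_)
    fun s hs => hC s (hmem s hs)
  refine hδ s (hmem s hs) _ (π.t_mem_Icc hi) ?_
  rw [abs_sub_comm, abs_of_nonneg (sub_nonneg.2 hs.2)]
  linarith [π.sub_le_mesh hi, hs.1]

lemma tendsto_sum_sub_smul (hx : Continuous x) (hA : ∀ t, HasDerivAt A (A' t) t)
    (hA' : Continuous A') :
    Tendsto (fun π : TimePartition T =>
        ∑ i ∈ Finset.range π.n, (x (π.t (i + 1)) - x (π.t i)) • A (π.t i))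
      (TimePartition.meshToZero T)
      (𝓝 (x T • A T - x 0 • A 0 - ∫ s in (0 : ℝ)..T, x s • A' s)) := by
  simp only [sum_sub_smul_eq]
  refine tendsto_const_nhds.sub (Metric.tendsto_nhds.2 fun ε hε => ?_)
  obtain ⟨C, hC⟩ := isCompact_Icc.exists_bound_of_continuousOn
    (hA'.continuousOn (s := Set.Icc 0 T))
  have huc := Metric.uniformContinuousOn_iff.1
    (isCompact_Icc.uniformContinuousOn_of_continuous (hx.continuousOn (s := Set.Icc 0 T)))
  obtain ⟨η, hη, hxη⟩ := huc (ε / (|C| * |T| + 1)) (by positivity)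
  have hmesh : Tendsto TimePartition.mesh (TimePartition.meshToZero T) (𝓝 0) := tendsto_comap
  filter_upwards [hmesh.eventually_lt_const hη] with π hπ
  rw [dist_comm, dist_eq_norm]
  have hC' : ∀ s ∈ Set.Icc 0 T, ‖A' s‖ ≤ |C| := fun s hs => (hC s hs).trans (le_abs_self C)
  calc _ ≤ ε / (|C| * |T| + 1) * |C| * T := norm_integral_sub_sum_le hx hA hA' π
        (fun s hs t ht hst => (hxη s hs t ht (hst.trans_lt hπ)).le) hC'
    _ ≤ ε / (|C| * |T| + 1) * |C| * |T| := by gcongr; exact le_abs_self T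
    _ < ε := by
      rw [mul_assoc, div_mul_eq_mul_div, div_lt_iff₀ (by positivity)]
      nlinarith

end RiemannStieltjes

section IteratedIntegral

variable {T : ℝ} {x y : ℝ → ℝ}

/-- The pathwise integral `∫_0^t e^{iλ(t-s)} dx(s)` minus `x t`. Unlike the pathwise integral it is
a `C¹` function of `t` when `x` is merely continuous. -/
def driftPart (x : ℝ → ℝ) (lam t : ℝ) : ℂ :=
  Complex.exp (Complex.I * lam * t) *
    (Complex.I * lam * (∫ s in (0 : ℝ)..t, (x s : ℂ) * Complex.exp (-(Complex.I * lam * s))) - x 0)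

/-- The iterated integral `∫_0^T ∫_0^t e^{iλ(t-s)} dx(s) dx(t)` of a path `x` whose quadratic
variation on `[0, T]` is `V`: the part `x t` of the inner integral contributes
`(x T ^ 2 - x 0 ^ 2 - V) / 2`, the `C¹` part is integrated by parts. -/
def iteratedIntegral (x : ℝ → ℝ) (V T lam : ℝ) : ℂ :=
  ((x T ^ 2 - x 0 ^ 2 - V) / 2 : ℝ) + (x T * driftPart x lam T + x 0 ^ 2 -
    ∫ s in (0 : ℝ)..T, (x s : ℂ) * (Complex.I * lam * (x s + driftPart x lam s)))

lemma driftPart_congr (h : Set.EqOn x y (Set.Icc 0 T)) (lam : ℝ) {t : ℝ}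
    (ht : t ∈ Set.Icc 0 T) : driftPart x lam t = driftPart y lam t := by
  have hint : ∫ s in (0 : ℝ)..t, (x s : ℂ) * Complex.exp (-(Complex.I * lam * s)) =
      ∫ s in (0 : ℝ)..t, (y s : ℂ) * Complex.exp (-(Complex.I * lam * s)) := by
    refine intervalIntegral.integral_congr fun s hs => ?_
    rw [Set.uIcc_of_le ht.1] at hs
    simp only [h ⟨hs.1, hs.2.trans ht.2⟩]
  simp only [driftPart, hint, h ⟨le_rfl, ht.1.trans ht.2⟩]

lemma iteratedIntegral_congr (hT : 0 ≤ T) (h : Set.EqOn x y (Set.Icc 0 T)) (V lam : ℝ) :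
    iteratedIntegral x V T lam = iteratedIntegral y V T lam := by
  have hint : ∫ s in (0 : ℝ)..T, (x s : ℂ) * (Complex.I * lam * (x s + driftPart x lam s)) =
      ∫ s in (0 : ℝ)..T, (y s : ℂ) * (Complex.I * lam * (y s + driftPart y lam s)) := by
    refine intervalIntegral.integral_congr fun s hs => ?_
    rw [Set.uIcc_of_le hT] at hs
    simp only [h hs, driftPart_congr h lam hs]
  have hT' : T ∈ Set.Icc 0 T := ⟨hT, le_rfl⟩
  simp only [iteratedIntegral, hint, h hT', h ⟨le_rfl, hT⟩, driftPart_congr h lam hT']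

lemma iteratedSum_congr (h : Set.EqOn x y (Set.Icc 0 T)) (lam : ℝ) (π : TimePartition T) :
    iteratedSum x lam π = iteratedSum y lam π := by
  refine Finset.sum_congr rfl fun i hi => ?_
  have hi := Finset.mem_range.1 hi
  rw [pathIntegral_congr h _ (π.t_mem_Icc hi.le), h (π.t_mem_Icc hi.le), h (π.t_mem_Icc hi)]

lemma hasDerivAt_cexp_I_mul (lam t : ℝ) :
    HasDerivAt (fun s : ℝ => Complex.exp (Complex.I * lam * s))
      (Complex.I * lam * Complex.exp (Complex.I * lam * t)) t := by
  have hlin : HasDerivAt (fun s : ℝ => Complex.I * lam * (s : ℂ)) (Complex.I * lam) t := by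
    simpa using (Complex.ofRealCLM.hasDerivAt (x := t)).const_mul (Complex.I * (lam : ℂ))
  simpa only [mul_comm] using hlin.cexp

lemma hasDerivAt_driftPart (hx : Continuous x) (lam t : ℝ) :
    HasDerivAt (driftPart x lam) (Complex.I * lam * (x t + driftPart x lam t)) t := by
  have hcont : Continuous fun s : ℝ => (x s : ℂ) * Complex.exp (-(Complex.I * lam * s)) := by
    fun_prop
  have hint := intervalIntegral.integral_hasDerivAt_right (hcont.intervalIntegrable 0 t)
    hcont.stronglyMeasurable.stronglyMeasurableAtFilter hcont.continuousAt
  refine ((hasDerivAt_cexp_I_mul lam t).mul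
    ((hint.const_mul (Complex.I * (lam : ℂ))).sub_const (x 0 : ℂ))).congr_deriv ?_
  have hcancel : Complex.exp (Complex.I * lam * t) * Complex.exp (-(Complex.I * lam * t)) = 1 := by
    rw [← Complex.exp_add, add_neg_cancel, Complex.exp_zero]
  simp only [driftPart]
  linear_combination (Complex.I * lam * x t) * hcancel

lemma continuous_driftPart (hx : Continuous x) (lam : ℝ) : Continuous (driftPart x lam) :=
  continuous_iff_continuousAt.2 fun t => (hasDerivAt_driftPart hx lam t).continuousAt

lemma driftPart_zero (x : ℝ → ℝ) (lam : ℝ) : driftPart x lam 0 = -x 0 := by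
  simp [driftPart]

lemma pathIntegral_cexp_neg (x : ℝ → ℝ) (lam τ : ℝ) :
    Complex.exp (Complex.I * lam * τ) *
        pathIntegral (fun s => Complex.exp (-(Complex.I * lam * s))) x τ =
      x τ + driftPart x lam τ := by
  have hderiv (s : ℝ) : deriv (fun s : ℝ => Complex.exp (-(Complex.I * lam * s))) s =
      -(Complex.I * lam) * Complex.exp (-(Complex.I * lam * s)) := by
    simpa using (hasDerivAt_cexp_I_mul (-lam) s).deriv
  have hcancel : Complex.exp (Complex.I * lam * τ) * Complex.exp (-(Complex.I * lam * τ)) = 1 := by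
    rw [← Complex.exp_add, add_neg_cancel, Complex.exp_zero]
  simp only [pathIntegral, hderiv, mul_left_comm _ (-(Complex.I * (lam : ℂ))),
    intervalIntegral.integral_const_mul, driftPart, Complex.ofReal_zero, mul_zero, neg_zero,
    Complex.exp_zero]
  linear_combination (x τ : ℂ) * hcancel

lemma pathIntegral_cexp_sub (x : ℝ → ℝ) (lam τ : ℝ) :
    pathIntegral (fun s => Complex.exp (Complex.I * lam * (τ - s))) x τ =
      x τ + driftPart x lam τ := by
  simp only [mul_sub, sub_eq_add_neg (Complex.I * lam * τ), Complex.exp_add,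
    pathIntegral_const_mul, pathIntegral_cexp_neg]

lemma periodogram_eq_norm_sq (x : ℝ → ℝ) (T lam : ℝ) :
    periodogram x T lam = ‖(x T : ℂ) + driftPart x lam T‖ ^ 2 := by
  have hconj (s : ℝ) : Complex.exp (Complex.I * lam * s) =
      starRingEnd ℂ (Complex.exp (-(Complex.I * lam * s))) := by
    simp [← Complex.exp_conj]
  have hunit : ‖Complex.exp (Complex.I * lam * T)‖ = 1 := by
    simp [Complex.norm_exp]
  rw [← pathIntegral_cexp_neg, norm_mul, hunit, one_mul, periodogram]
  simp only [hconj]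
  rw [pathIntegral_conj, RCLike.norm_conj]

lemma norm_driftPart_sq (hx : Continuous x) (lam T : ℝ) :
    ‖driftPart x lam T‖ ^ 2 = x 0 ^ 2 - 2 * (∫ s in (0 : ℝ)..T,
      (x s : ℂ) * (Complex.I * lam * (x s + driftPart x lam s))).re := by
  have hdrift := continuous_driftPart hx lam
  have hcont : Continuous fun s : ℝ =>
      (x s : ℂ) * (Complex.I * lam * (x s + driftPart x lam s)) := by fun_prop
  have hre : ∫ s in (0 : ℝ)..T, ((x s : ℂ) * (Complex.I * lam * (x s + driftPart x lam s))).re =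
      (∫ s in (0 : ℝ)..T, (x s : ℂ) * (Complex.I * lam * (x s + driftPart x lam s))).re :=
    Complex.reCLM.intervalIntegral_comp_comm (hcont.intervalIntegrable 0 T)
  have hderiv (t : ℝ) : HasDerivAt (fun t => ‖driftPart x lam t‖ ^ 2)
      (-2 * ((x t : ℂ) * (Complex.I * lam * (x t + driftPart x lam t))).re) t := by
    refine (hasDerivAt_driftPart hx lam t).norm_sq.congr_deriv ?_
    simp [Complex.inner]
    ring
  have hftc := intervalIntegral.integral_eq_sub_of_hasDerivAt (fun t _ => hderiv t)
    ((continuous_const.mul (Complex.continuous_re.comp hcont)).intervalIntegrable 0 T)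
  simp only [intervalIntegral.integral_const_mul, hre, driftPart_zero, norm_neg, Complex.norm_real,
    Real.norm_eq_abs, sq_abs] at hftc
  linarith

lemma periodogram_eq_of_continuous (hx : Continuous x) (V T lam : ℝ) :
    periodogram x T lam = V + 2 * (iteratedIntegral x V T lam).re := by
  have hnorm : ‖(x T : ℂ) + driftPart x lam T‖ ^ 2 =
      x T ^ 2 + 2 * (x T * (driftPart x lam T).re) + ‖driftPart x lam T‖ ^ 2 := by
    simp only [Complex.sq_norm, Complex.normSq_apply, Complex.add_re, Complex.ofReal_re,
      Complex.add_im, Complex.ofReal_im]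
    ring
  have hre : (iteratedIntegral x V T lam).re = (x T ^ 2 - x 0 ^ 2 - V) / 2 +
      (x T * (driftPart x lam T).re + x 0 ^ 2 - (∫ s in (0 : ℝ)..T,
        (x s : ℂ) * (Complex.I * lam * (x s + driftPart x lam s))).re) := by
    rw [iteratedIntegral, Complex.add_re, Complex.sub_re, Complex.add_re, Complex.ofReal_re,
      Complex.re_ofReal_mul, ← Complex.ofReal_pow, Complex.ofReal_re]
  rw [periodogram_eq_norm_sq, hnorm, norm_driftPart_sq hx, hre]
  ring

variable {ι : Type*} {l : Filter ι} {π : ι → TimePartition T} {V : ℝ}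

lemma iteratedSum_eq (x : ℝ → ℝ) (lam : ℝ) (π : TimePartition T) :
    iteratedSum x lam π = ((x T ^ 2 - x 0 ^ 2 - quadSum x π) / 2 : ℝ) +
      ∑ i ∈ Finset.range π.n, (x (π.t (i + 1)) - x (π.t i)) • driftPart x lam (π.t i) := by
  have hsq : (x T ^ 2 - x 0 ^ 2 - quadSum x π) / 2 =
      ∑ i ∈ Finset.range π.n, x (π.t i) * (x (π.t (i + 1)) - x (π.t i)) := by
    rw [quadSum_eq_sub_two_mul_sum]
    ring
  rw [hsq, Complex.ofReal_sum, ← Finset.sum_add_distrib]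
  refine Finset.sum_congr rfl fun i _ => ?_
  rw [pathIntegral_cexp_sub, Complex.real_smul]
  push_cast
  ring

lemma tendsto_iteratedSum_of_continuous (hx : Continuous x)
    (hπ : Tendsto π l (TimePartition.meshToZero T))
    (hV : Tendsto (fun k => quadSum x (π k)) l (𝓝 V)) (lam : ℝ) :
    Tendsto (fun k => iteratedSum x lam (π k)) l (𝓝 (iteratedIntegral x V T lam)) := by
  have hdrift := continuous_driftPart hx lam
  have hsmooth := (tendsto_sum_sub_smul hx (hasDerivAt_driftPart hx lam) (by fun_prop)).comp hπ
  have hsq : Tendsto (fun k => (((x T ^ 2 - x 0 ^ 2 - quadSum x (π k)) / 2 : ℝ) : ℂ)) l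
      (𝓝 (((x T ^ 2 - x 0 ^ 2 - V) / 2 : ℝ) : ℂ)) :=
    (Complex.continuous_ofReal.tendsto _).comp ((hV.const_sub _).div_const 2)
  have hlim : iteratedIntegral x V T lam = ((x T ^ 2 - x 0 ^ 2 - V) / 2 : ℝ) +
      (x T • driftPart x lam T - x 0 • driftPart x lam 0 -
        ∫ s in (0 : ℝ)..T, x s • (Complex.I * lam * (x s + driftPart x lam s))) := by
    simp only [iteratedIntegral, driftPart_zero, Complex.real_smul]
    ring
  simp only [iteratedSum_eq, hlim]
  exact hsq.add hsmooth

lemma exists_continuous_eqOn_Icc (hT : 0 ≤ T) (hx : ContinuousOn x (Set.Icc 0 T)) :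
    ∃ y, Continuous y ∧ Set.EqOn x y (Set.Icc 0 T) :=
  ⟨Set.IccExtend hT ((Set.Icc 0 T).domRestrict x), hx.domRestrict.Icc_extend',
    fun t ht => by rw [Set.IccExtend_of_mem hT _ ht, Set.domRestrict_apply]⟩

theorem periodogram_eq (hT : 0 ≤ T) (hx : ContinuousOn x (Set.Icc 0 T)) (V lam : ℝ) :
    periodogram x T lam = V + 2 * (iteratedIntegral x V T lam).re := by
  obtain ⟨y, hy, hxy⟩ := exists_continuous_eqOn_Icc hT hx
  rw [iteratedIntegral_congr hT hxy, ← periodogram_eq_of_continuous hy, periodogram, periodogram,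
    pathIntegral_congr hxy _ ⟨hT, le_rfl⟩]

theorem tendsto_iteratedSum (hT : 0 ≤ T) (hx : ContinuousOn x (Set.Icc 0 T))
    (hπ : Tendsto π l (TimePartition.meshToZero T))
    (hV : Tendsto (fun k => quadSum x (π k)) l (𝓝 V)) (lam : ℝ) :
    Tendsto (fun k => iteratedSum x lam (π k)) l (𝓝 (iteratedIntegral x V T lam)) := by
  obtain ⟨y, hy, hxy⟩ := exists_continuous_eqOn_Icc hT hx
  simp only [iteratedIntegral_congr hT hxy, iteratedSum_congr hxy, quadSum_congr hxy] at hV ⊢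
  exact tendsto_iteratedSum_of_continuous hy hπ hV lam

end IteratedIntegral

section MaximalInequality

variable {α : Type*} {S : ℕ → α → ℝ} {ε : ℝ} {m N : ℕ}

/-- The event that `k` is the last index up to `N` at which `|S|` reaches the level `ε`; it plays
the role of a stopping time for a reverse-time martingale. -/
def lastExceedance (S : ℕ → α → ℝ) (ε : ℝ) (N k : ℕ) : Set α :=
  {y | ε ≤ |S k y| ∧ ∀ l ∈ Finset.Ioc k N, |S l y| < ε}

lemma exists_exceedance_subset (S : ℕ → α → ℝ) (ε : ℝ) (m N : ℕ) :
    {y | ∃ k ∈ Finset.Icc m N, ε ≤ |S k y|} ⊆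
      ⋃ k ∈ Finset.Icc m N, lastExceedance S ε N k := by
  rintro y ⟨k, hk, hky⟩
  obtain ⟨j, hj, hmax⟩ := ((Finset.Icc m N).filter fun k => ε ≤ |S k y|).exists_maximal
    ⟨k, Finset.mem_filter.2 ⟨hk, hky⟩⟩
  rw [Finset.mem_filter] at hj
  refine Set.mem_iUnion₂.2 ⟨j, hj.1, hj.2, fun l hl => not_le.1 fun hc => ?_⟩
  have hlIcc : l ∈ Finset.Icc m N := by
    rw [Finset.mem_Icc, Finset.mem_Ioc] at *
    omega
  exact (Finset.mem_Ioc.1 hl).1.not_ge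
    (hmax (Finset.mem_filter.2 ⟨hlIcc, hc⟩) (Finset.mem_Ioc.1 hl).1.le)

lemma disjoint_lastExceedance {i j : ℕ} (hij : i < j) (hj : j ≤ N) :
    Disjoint (lastExceedance S ε N i) (lastExceedance S ε N j) :=
  Set.disjoint_left.2 fun _ hi hj' => (hi.2 j (Finset.mem_Ioc.2 ⟨hij, hj⟩)).not_ge hj'.1

lemma pairwise_disjoint_lastExceedance (S : ℕ → α → ℝ) (ε : ℝ) (m N : ℕ) :
    (Finset.Icc m N : Set ℕ).Pairwise (Function.onFun Disjoint (lastExceedance S ε N)) := by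
  intro i hi j hj hij
  rw [Finset.mem_coe, Finset.mem_Icc] at hi hj
  rcases hij.lt_or_gt with h | h
  · exact disjoint_lastExceedance h hj.2
  · exact (disjoint_lastExceedance h hi.2).symm

variable [MeasurableSpace α] {μ : Measure α}

lemma measurableSet_lastExceedance (hS : ∀ k, Measurable (S k)) (ε : ℝ) (N k : ℕ) :
    MeasurableSet (lastExceedance S ε N k) := by
  have hinter : lastExceedance S ε N k =
      {y | ε ≤ |S k y|} ∩ ⋂ l ∈ Finset.Ioc k N, {y | |S l y| < ε} := by
    ext y
    simp [lastExceedance]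
  rw [hinter]
  exact (measurableSet_le measurable_const (hS k).abs).inter
    (Finset.measurableSet_biInter _ fun l _ => measurableSet_lt (hS l).abs measurable_const)

lemma sq_mul_measureReal_exists_le [IsFiniteMeasure μ] (hS : ∀ k, Measurable (S k))
    (hS2 : ∀ k, Integrable (fun y => S k y ^ 2) μ) (hε : 0 ≤ ε)
    (hlast : ∀ k ∈ Finset.Icc m N, ∫ y in lastExceedance S ε N k, S k y ^ 2 ∂μ ≤
      ∫ y in lastExceedance S ε N k, S m y ^ 2 ∂μ) :
    ε ^ 2 * μ.real {y | ∃ k ∈ Finset.Icc m N, ε ≤ |S k y|} ≤ ∫ y, S m y ^ 2 ∂μ := by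
  have hmeas := measurableSet_lastExceedance hS ε N
  have hmarkov (k : ℕ) : ε ^ 2 * μ.real (lastExceedance S ε N k) ≤
      ∫ y in lastExceedance S ε N k, S k y ^ 2 ∂μ := by
    refine setIntegral_ge_of_const_le_real (hmeas k) (measure_ne_top _ _) (fun y hy => ?_)
      (hS2 k).integrableOn
    rw [← sq_abs (S k y)]
    exact pow_le_pow_left₀ hε hy.1 2
  calc ε ^ 2 * μ.real {y | ∃ k ∈ Finset.Icc m N, ε ≤ |S k y|}
      ≤ ε ^ 2 * ∑ k ∈ Finset.Icc m N, μ.real (lastExceedance S ε N k) := by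
        gcongr
        exact (measureReal_mono (exists_exceedance_subset S ε m N) (measure_ne_top _ _)).trans
          (measureReal_biUnion_finset_le _ _)
    _ ≤ ∑ k ∈ Finset.Icc m N, ∫ y in lastExceedance S ε N k, S m y ^ 2 ∂μ := by
        rw [Finset.mul_sum]
        exact Finset.sum_le_sum fun k hk => (hmarkov k).trans (hlast k hk)
    _ = ∫ y in ⋃ k ∈ Finset.Icc m N, lastExceedance S ε N k, S m y ^ 2 ∂μ :=
        (integral_biUnion_finset _ (fun k _ => hmeas k) (pairwise_disjoint_lastExceedance S ε m N)
          fun k _ => (hS2 m).integrableOn).symm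
    _ ≤ ∫ y, S m y ^ 2 ∂μ :=
        setIntegral_le_integral (hS2 m) (ae_of_all _ fun y => sq_nonneg _)

lemma integral_sq_le_of_integral_sub_mul_eq_zero {f g : α → ℝ} (hf : MemLp f 2 μ)
    (hg : MemLp g 2 μ) (horth : ∫ y, (f y - g y) * g y ∂μ = 0) :
    ∫ y, g y ^ 2 ∂μ ≤ ∫ y, f y ^ 2 ∂μ := by
  have hmul : Integrable (fun y => (f y - g y) * g y) μ := (hf.sub hg).integrable_mul hg
  calc ∫ y, g y ^ 2 ∂μ = ∫ y, (g y ^ 2 + 2 * ((f y - g y) * g y)) ∂μ := by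
        rw [integral_add hg.integrable_sq (hmul.const_mul 2), integral_const_mul, horth, mul_zero,
          add_zero]
    _ ≤ ∫ y, f y ^ 2 ∂μ :=
        integral_mono (hg.integrable_sq.add (hmul.const_mul 2)) hf.integrable_sq fun y => by
          dsimp only
          linarith [sq_nonneg (f y - g y)]

lemma integral_add_sq_mul {f g G : α → ℝ} (hf : Integrable (fun y => f y ^ 2 * G y) μ)
    (hg : Integrable (fun y => g y ^ 2 * G y) μ) (hfg : Integrable (fun y => f y * g y * G y) μ)
    (horth : ∫ y, f y * g y * G y ∂μ = 0) :
    ∫ y, (f y + g y) ^ 2 * G y ∂μ = ∫ y, f y ^ 2 * G y ∂μ + ∫ y, g y ^ 2 * G y ∂μ := by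
  have hsq : Integrable (fun y => f y ^ 2 * G y + g y ^ 2 * G y) μ := hf.add hg
  calc ∫ y, (f y + g y) ^ 2 * G y ∂μ
      = ∫ y, (f y ^ 2 * G y + g y ^ 2 * G y + 2 * (f y * g y * G y)) ∂μ := by
        congr with y
        ring
    _ = ∫ y, f y ^ 2 * G y ∂μ + ∫ y, g y ^ 2 * G y ∂μ := by
        rw [integral_add hsq (hfg.const_mul 2), integral_add hf hg, integral_const_mul, horth,
          mul_zero, add_zero]

lemma integral_eq_zero_of_comp_eq_neg {E : Type*} [NormedAddCommGroup E] [NormedSpace ℝ E]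
    {R : α → α} (hR : MeasurePreserving R μ μ) {F : α → E} (hF : AEStronglyMeasurable F μ)
    (hneg : ∀ y, F (R y) = -F y) : ∫ y, F y ∂μ = 0 := by
  have hodd : ∫ y, F y ∂μ = -∫ y, F y ∂μ :=
    calc ∫ y, F y ∂μ = ∫ y, F y ∂μ.map R := by rw [hR.map_eq]
      _ = ∫ y, F (R y) ∂μ := integral_map hR.aemeasurable (by rwa [hR.map_eq])
      _ = -∫ y, F y ∂μ := by simp only [hneg, integral_neg]
  have := IsAddTorsionFree.of_isTorsionFree ℝ E
  exact self_eq_neg.1 hodd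

end MaximalInequality

section StepPath

variable {T : ℝ} {π σ : TimePartition T}

/-- The step path with jump `y i` immediately after the `i`-th point of `π`. -/
def stepPath (π : TimePartition T) (y : Fin π.n → ℝ) (t : ℝ) : ℝ :=
  ∑ i : Fin π.n, if π.t i < t then y i else 0

/-- Reflection of a step path on the time interval `[u, v)`: the jumps at the partition points in
this interval change sign. -/
def reflectOn (π : TimePartition T) (u v : ℝ) (y : Fin π.n → ℝ) (i : Fin π.n) : ℝ :=
  if u ≤ π.t i ∧ π.t i < v then -y i else y i

/-- `G` is invariant under the reflections between any two points of `σ`. -/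
def IsReflectionInvariant {β : Type*} (π σ : TimePartition T) (G : (Fin π.n → ℝ) → β) : Prop :=
  ∀ u ∈ σ.points, ∀ v ∈ σ.points, ∀ y, G (reflectOn π u v y) = G y

lemma stepPath_sub (π : TimePartition T) (y : Fin π.n → ℝ) {a b : ℝ} (hab : a ≤ b) :
    stepPath π y b - stepPath π y a =
      ∑ i : Fin π.n, if a ≤ π.t i ∧ π.t i < b then y i else 0 := by
  rw [stepPath, stepPath, ← Finset.sum_sub_distrib]
  refine Finset.sum_congr rfl fun i _ => ?_
  split_ifs <;> grind

lemma stepPath_reflectOn_sub_of_subset (π : TimePartition T) (y : Fin π.n → ℝ) {a b u v : ℝ}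
    (hab : a ≤ b) (hua : u ≤ a) (hbv : b ≤ v) :
    stepPath π (reflectOn π u v y) b - stepPath π (reflectOn π u v y) a =
      -(stepPath π y b - stepPath π y a) := by
  rw [stepPath_sub π _ hab, stepPath_sub π _ hab, ← Finset.sum_neg_distrib]
  refine Finset.sum_congr rfl fun i _ => ?_
  rw [reflectOn]
  split_ifs <;> grind

lemma stepPath_reflectOn_sub_of_disjoint (π : TimePartition T) (y : Fin π.n → ℝ) {a b u v : ℝ}
    (hab : a ≤ b) (hdisj : b ≤ u ∨ v ≤ a) :
    stepPath π (reflectOn π u v y) b - stepPath π (reflectOn π u v y) a =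
      stepPath π y b - stepPath π y a := by
  rw [stepPath_sub π _ hab, stepPath_sub π _ hab]
  refine Finset.sum_congr rfl fun i _ => ?_
  rw [reflectOn]
  split_ifs <;> grind

lemma stepPath_increments (π : TimePartition T) (x : ℝ → ℝ) {j : ℕ} (hj : j ≤ π.n) :
    stepPath π (fun i => x (π.t (i + 1)) - x (π.t i)) (π.t j) = x (π.t j) - x (π.t 0) := by
  have hlt (i : Fin π.n) : π.t i < π.t j ↔ (i : ℕ) < j :=
    ⟨fun h => not_le.1 fun hji => (π.t_le_t hji i.2.le).not_gt h, fun h => π.t_lt_t h hj⟩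
  simp only [stepPath, hlt]
  rw [Fin.sum_univ_eq_sum_range (fun i => if i < j then x (π.t (i + 1)) - x (π.t i) else 0),
    ← Finset.sum_filter, ← Finset.sum_range_sub fun i => x (π.t i)]
  refine Finset.sum_congr ?_ fun _ _ => rfl
  ext i
  simp only [Finset.mem_filter, Finset.mem_range]
  omega

lemma quadSum_stepPath_increments (h : σ.points ⊆ π.points) (x : ℝ → ℝ) :
    quadSum (stepPath π fun i => x (π.t (i + 1)) - x (π.t i)) σ = quadSum x σ := by
  have hstep {i : ℕ} (hi : i ≤ σ.n) :
      stepPath π (fun i => x (π.t (i + 1)) - x (π.t i)) (σ.t i) = x (σ.t i) - x (π.t 0) := by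
    obtain ⟨j, hj, hji⟩ := h (σ.t_mem_points hi)
    rw [← hji, stepPath_increments π x hj]
  refine Finset.sum_congr rfl fun i hi => ?_
  have hi := Finset.mem_range.1 hi
  rw [hstep hi, hstep hi.le, sub_sub_sub_cancel_right]

lemma IsReflectionInvariant.mono {β : Type*} {τ : TimePartition T} {G : (Fin π.n → ℝ) → β}
    (hG : IsReflectionInvariant π σ G) (h : τ.points ⊆ σ.points) :
    IsReflectionInvariant π τ G :=
  fun u hu v hv => hG u (h hu) v (h hv)

lemma isReflectionInvariant_quadSum_stepPath (π σ : TimePartition T) :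
    IsReflectionInvariant π σ fun y => quadSum (stepPath π y) σ := by
  rintro _ ⟨p, hp, rfl⟩ _ ⟨q, hq, rfl⟩ y
  refine Finset.sum_congr rfl fun j hj => ?_
  have hj := Finset.mem_range.1 hj
  have hab := (σ.t_lt j hj).le
  by_cases hpq : p ≤ j ∧ j < q
  · rw [stepPath_reflectOn_sub_of_subset π y hab (σ.t_le_t hpq.1 hj.le) (σ.t_le_t hpq.2 hq),
      neg_sq]
  · rw [stepPath_reflectOn_sub_of_disjoint π y hab]
    rcases not_and_or.1 hpq with h | h
    · exact Or.inl (σ.t_le_t (not_le.1 h) hp)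
    · exact Or.inr (σ.t_le_t (not_lt.1 h) hj.le)

lemma measurable_stepPath (π : TimePartition T) (t : ℝ) : Measurable fun y => stepPath π y t := by
  refine Finset.measurable_sum _ fun i _ => ?_
  split_ifs
  · exact measurable_pi_apply i
  · exact measurable_const

lemma measurable_quadSum_stepPath (π σ : TimePartition T) :
    Measurable fun y => quadSum (stepPath π y) σ :=
  Finset.measurable_sum _ fun _ _ =>
    ((measurable_stepPath π _).sub (measurable_stepPath π _)).pow_const 2

instance holderTriple_four_four_two : ENNReal.HolderTriple 4 4 2 where
  inv_add_inv_eq_inv := by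
    rw [show (4 : ℝ≥0∞) = 2 * 2 by norm_num, ENNReal.mul_inv (by simp) (by simp), ← mul_add,
      ENNReal.inv_two_add_inv_two, mul_one]

section Moments

variable {μ : Measure (Fin π.n → ℝ)}

lemma memLp_stepPath_sub (h4 : ∀ i, MemLp (fun y : Fin π.n → ℝ => y i) 4 μ) (a b : ℝ) :
    MemLp (fun y => stepPath π y b - stepPath π y a) 4 μ := by
  have hstep (t : ℝ) : MemLp (fun y => stepPath π y t) 4 μ := by
    refine memLp_finsetSum _ fun i _ => ?_
    split_ifs
    · exact h4 i
    · exact MemLp.zero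
  exact (hstep b).sub (hstep a)

lemma memLp_stepPath_sub_mul_sub (h4 : ∀ i, MemLp (fun y : Fin π.n → ℝ => y i) 4 μ)
    (a b c d : ℝ) :
    MemLp (fun y => (stepPath π y b - stepPath π y a) * (stepPath π y d - stepPath π y c)) 2 μ :=
  (memLp_stepPath_sub h4 c d).mul (memLp_stepPath_sub h4 a b)

lemma memLp_quadSum_stepPath (h4 : ∀ i, MemLp (fun y : Fin π.n → ℝ => y i) 4 μ)
    (σ : TimePartition T) : MemLp (fun y => quadSum (stepPath π y) σ) 2 μ := by
  refine memLp_finsetSum _ fun i _ => ?_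
  simpa only [sq] using memLp_stepPath_sub_mul_sub h4 _ _ _ _

variable {G : (Fin π.n → ℝ) → ℝ}

lemma integral_sub_mul_sub_mul_eq_zero
    (hμ : ∀ u v, MeasurePreserving (reflectOn π u v) μ μ) (hGm : AEStronglyMeasurable G μ)
    (hG : IsReflectionInvariant π σ G) {p q : ℕ} (hpq : p ≤ q) (hq : q < σ.n) :
    ∫ y, (stepPath π y (σ.t q) - stepPath π y (σ.t p)) *
      (stepPath π y (σ.t (q + 1)) - stepPath π y (σ.t q)) * G y ∂μ = 0 := by
  refine integral_eq_zero_of_comp_eq_neg (hμ (σ.t q) (σ.t (q + 1)))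
    (((((measurable_stepPath π _).sub (measurable_stepPath π _)).mul
      ((measurable_stepPath π _).sub (measurable_stepPath π _))).aestronglyMeasurable).mul hGm)
    fun y => ?_
  rw [hG _ (σ.t_mem_points hq.le) _ (σ.t_mem_points hq),
    stepPath_reflectOn_sub_of_subset π y (σ.t_lt q hq).le le_rfl le_rfl,
    stepPath_reflectOn_sub_of_disjoint π y (σ.t_le_t hpq hq.le) (Or.inl le_rfl)]
  ring

lemma integrable_sq_stepPath_sub_mul (h4 : ∀ i, MemLp (fun y : Fin π.n → ℝ => y i) 4 μ)
    (hG : MemLp G 2 μ) (a b : ℝ) :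
    Integrable (fun y => (stepPath π y b - stepPath π y a) ^ 2 * G y) μ := by
  simp only [sq]
  exact (memLp_stepPath_sub_mul_sub h4 a b a b).integrable_mul hG

lemma integral_sq_sub_mul_eq_sum (h4 : ∀ i, MemLp (fun y : Fin π.n → ℝ => y i) 4 μ)
    (hμ : ∀ u v, MeasurePreserving (reflectOn π u v) μ μ) (hG2 : MemLp G 2 μ)
    (hG : IsReflectionInvariant π σ G) {p q : ℕ} (hpq : p ≤ q) (hq : q ≤ σ.n) :
    ∫ y, (stepPath π y (σ.t q) - stepPath π y (σ.t p)) ^ 2 * G y ∂μ =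
      ∑ j ∈ Finset.Ico p q,
        ∫ y, (stepPath π y (σ.t (j + 1)) - stepPath π y (σ.t j)) ^ 2 * G y ∂μ := by
  induction q, hpq using Nat.le_induction with
  | base => simp
  | succ q hpq ih =>
    have hsq := integrable_sq_stepPath_sub_mul h4 hG2
    rw [Finset.sum_Ico_succ_top hpq, ← ih (Nat.le_of_succ_le hq),
      ← integral_add_sq_mul (hsq _ _) (hsq _ _)
        ((memLp_stepPath_sub_mul_sub h4 _ _ _ _).integrable_mul hG2)
        (integral_sub_mul_sub_mul_eq_zero hμ hG2.1 hG hpq hq)]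
    simp only [sub_add_sub_cancel']

end Moments

end StepPath

lemma TimePartition.exists_index_of_points_subset {T : ℝ} {σ τ : TimePartition T}
    (h : τ.points ⊆ σ.points) :
    ∃ idx : ℕ → ℕ, idx 0 = 0 ∧ idx τ.n = σ.n ∧
      ∀ i ≤ τ.n, idx i ≤ σ.n ∧ σ.t (idx i) = τ.t i := by
  choose! idx hidx using fun (i : ℕ) (hi : i ≤ τ.n) => h (τ.t_mem_points hi)
  have hzero := hidx 0 (Nat.zero_le _)
  have hlast := hidx τ.n le_rfl
  refine ⟨idx, Nat.le_zero.1 (σ.le_of_t_le_t hzero.1 ?_),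
    hlast.1.antisymm (σ.le_of_t_le_t le_rfl ?_), hidx⟩
  · rw [hzero.2, τ.t_zero, σ.t_zero]
  · rw [hlast.2, τ.t_last, σ.t_last]

section ReverseMartingale

variable {T : ℝ} {π : TimePartition T} {μ : Measure (Fin π.n → ℝ)}

/-- The reverse-martingale property of the sums of squares, with reflection-invariant weights in
place of functions measurable with respect to the sums over finer partitions. -/
lemma integral_quadSum_mul_eq (h4 : ∀ i, MemLp (fun y : Fin π.n → ℝ => y i) 4 μ)
    (hμ : ∀ u v, MeasurePreserving (reflectOn π u v) μ μ) {σ τ : TimePartition T}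
    (hτ : τ.points ⊆ σ.points) {G : (Fin π.n → ℝ) → ℝ} (hG2 : MemLp G 2 μ)
    (hG : IsReflectionInvariant π σ G) :
    ∫ y, quadSum (stepPath π y) τ * G y ∂μ = ∫ y, quadSum (stepPath π y) σ * G y ∂μ := by
  obtain ⟨idx, hzero, hlast, hidx⟩ := TimePartition.exists_index_of_points_subset hτ
  have hsum (ν : TimePartition T) : ∫ y, quadSum (stepPath π y) ν * G y ∂μ =
      ∑ j ∈ Finset.range ν.n,
        ∫ y, (stepPath π y (ν.t (j + 1)) - stepPath π y (ν.t j)) ^ 2 * G y ∂μ := by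
    simp only [quadSum, Finset.sum_mul]
    exact integral_finsetSum _ fun j _ => integrable_sq_stepPath_sub_mul h4 hG2 _ _
  set c : ℕ → ℝ := fun j =>
    ∫ y, (stepPath π y (σ.t (j + 1)) - stepPath π y (σ.t j)) ^ 2 * G y ∂μ
  have hblock (i : ℕ) (hi : i < τ.n) :
      ∫ y, (stepPath π y (τ.t (i + 1)) - stepPath π y (τ.t i)) ^ 2 * G y ∂μ =
        ∑ j ∈ Finset.range (idx (i + 1)), c j - ∑ j ∈ Finset.range (idx i), c j := by
    have hle : idx i ≤ idx (i + 1) := σ.le_of_t_le_t (hidx i hi.le).1 <| by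
      rw [(hidx i hi.le).2, (hidx (i + 1) hi).2]
      exact (τ.t_lt i hi).le
    rw [← (hidx i hi.le).2, ← (hidx (i + 1) hi).2, ← Finset.sum_Ico_eq_sub c hle]
    exact integral_sq_sub_mul_eq_sum h4 hμ hG2 hG hle (hidx (i + 1) hi).1
  rw [hsum τ, hsum σ, Finset.sum_congr rfl fun i hi => hblock i (Finset.mem_range.1 hi),
    Finset.sum_range_sub fun i => ∑ j ∈ Finset.range (idx i), c j, hzero, hlast,
    Finset.range_zero, Finset.sum_empty, sub_zero]

lemma IsReflectionInvariant.lastExceedance_indicator {σ : TimePartition T}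
    {S : ℕ → (Fin π.n → ℝ) → ℝ} {k N : ℕ}
    (hS : ∀ l, k ≤ l → IsReflectionInvariant π σ (S l)) (ε : ℝ) :
    IsReflectionInvariant π σ ((lastExceedance S ε N k).indicator (S k)) := by
  intro u hu v hv y
  have hmem : reflectOn π u v y ∈ lastExceedance S ε N k ↔ y ∈ lastExceedance S ε N k :=
    and_congr (by rw [hS k le_rfl u hu v hv]) <| forall₂_congr fun l hl => by
      rw [hS l (Finset.mem_Ioc.1 hl).1.le u hu v hv]
  by_cases hy : y ∈ lastExceedance S ε N k
  · rw [Set.indicator_of_mem hy, Set.indicator_of_mem (hmem.2 hy), hS k le_rfl u hu v hv]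
  · rw [Set.indicator_of_notMem hy, Set.indicator_of_notMem (mt hmem.1 hy)]

lemma sq_mul_measureReal_exists_quadSum_le [IsFiniteMeasure μ]
    (h4 : ∀ i, MemLp (fun y : Fin π.n → ℝ => y i) 4 μ)
    (hμ : ∀ u v, MeasurePreserving (reflectOn π u v) μ μ) {ρ : ℕ → TimePartition T}
    (hρ : Monotone fun k => (ρ k).points) (m N : ℕ) (c : ℝ) {ε : ℝ} (hε : 0 ≤ ε) :
    ε ^ 2 * μ.real {y | ∃ k ∈ Finset.Icc m N, ε ≤ |quadSum (stepPath π y) (ρ k) - c|} ≤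
      ∫ y, (quadSum (stepPath π y) (ρ m) - c) ^ 2 ∂μ := by
  set S : ℕ → (Fin π.n → ℝ) → ℝ := fun k y => quadSum (stepPath π y) (ρ k) - c
  have hSm (k : ℕ) : Measurable (S k) := (measurable_quadSum_stepPath π (ρ k)).sub_const c
  have hS2 (k : ℕ) : MemLp (S k) 2 μ := (memLp_quadSum_stepPath h4 (ρ k)).sub (memLp_const c)
  refine sq_mul_measureReal_exists_le hSm (fun k => (hS2 k).integrable_sq) hε fun k hk => ?_
  set A := lastExceedance S ε N k
  have hA : MeasurableSet A := measurableSet_lastExceedance hSm ε N k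
  have hG2 : MemLp (A.indicator (S k)) 2 μ := (hS2 k).indicator hA
  have hGinv : IsReflectionInvariant π (ρ k) (A.indicator (S k)) :=
    IsReflectionInvariant.lastExceedance_indicator (fun l hl u hu v hv y => congrArg (· - c)
      ((isReflectionInvariant_quadSum_stepPath π (ρ l)).mono (hρ hl) u hu v hv y)) ε
  have hquad (j : ℕ) : Integrable (fun y => quadSum (stepPath π y) (ρ j) * A.indicator (S k) y) μ :=
    (memLp_quadSum_stepPath h4 (ρ j)).integrable_mul hG2
  refine integral_sq_le_of_integral_sub_mul_eq_zero ((hS2 m).restrict A) ((hS2 k).restrict A) ?_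
  calc ∫ y in A, (S m y - S k y) * S k y ∂μ
      = ∫ y, (quadSum (stepPath π y) (ρ m) * A.indicator (S k) y -
          quadSum (stepPath π y) (ρ k) * A.indicator (S k) y) ∂μ := by
        rw [← integral_indicator hA]
        congr with y
        by_cases hy : y ∈ A
        · simp only [Set.indicator_of_mem hy, S]
          ring
        · simp only [Set.indicator_of_notMem hy, mul_zero, sub_zero]
    _ = 0 := by
        rw [integral_sub (hquad m) (hquad k),
          integral_quadSum_mul_eq h4 hμ (hρ (Finset.mem_Icc.1 hk).1) hG2 hGinv, sub_self]

end ReverseMartingale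

section ProductMeasure

variable {T : ℝ} {π : TimePartition T} {μ : Fin π.n → Measure ℝ} [∀ i, IsProbabilityMeasure (μ i)]

lemma measurePreserving_reflectOn_pi (hμ : ∀ i, MeasurePreserving (fun x : ℝ => -x) (μ i) (μ i))
    (u v : ℝ) : MeasurePreserving (reflectOn π u v) (Measure.pi μ) (Measure.pi μ) := by
  refine measurePreserving_pi μ μ
    (f := fun i x => if u ≤ π.t i ∧ π.t i < v then -x else x) fun i => ?_
  split_ifs
  · exact hμ i
  · exact MeasurePreserving.id _

lemma memLp_coordinate_pi {p : ℝ≥0∞} (hμ : ∀ i, MemLp id p (μ i)) (i : Fin π.n) :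
    MemLp (fun y : Fin π.n → ℝ => y i) p (Measure.pi μ) :=
  (hμ i).comp_measurePreserving (measurePreserving_eval μ i)

end ProductMeasure

section Gaussian

lemma gaussianReal_zero_eq_map_sqrt_mul (v : ℝ≥0) :
    gaussianReal 0 v = (gaussianReal 0 1).map (√(v : ℝ) * ·) := by
  rw [gaussianReal_map_const_mul, mul_zero, mul_one]
  congr 1
  ext
  simp

lemma integral_pow_gaussianReal_zero (v : ℝ≥0) (r : ℕ) :
    ∫ x, x ^ r ∂gaussianReal 0 v = √(v : ℝ) ^ r * ∫ x, x ^ r ∂gaussianReal 0 1 := by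
  rw [gaussianReal_zero_eq_map_sqrt_mul v, integral_map (by fun_prop) (by fun_prop)]
  simp only [mul_pow, integral_const_mul]

lemma integral_sq_gaussianReal_zero (v : ℝ≥0) : ∫ x, x ^ 2 ∂gaussianReal 0 v = v := by
  have h := variance_fun_id_gaussianReal (μ := 0) (v := v)
  rwa [variance_of_integral_eq_zero (by fun_prop) (by simp)] at h

lemma lintegral_enorm_rpow_gaussianReal_zero (v : ℝ≥0) {p : ℝ} (hp : 0 ≤ p) :
    ∫⁻ x, ‖x‖ₑ ^ p ∂gaussianReal 0 v =
      (v : ℝ≥0∞) ^ (p / 2) * ∫⁻ x, ‖x‖ₑ ^ p ∂gaussianReal 0 1 := by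
  have hsqrt : ‖√(v : ℝ)‖ₑ ^ p = (v : ℝ≥0∞) ^ (p / 2) := by
    rw [Real.enorm_of_nonneg (Real.sqrt_nonneg _), Real.sqrt_eq_rpow,
      ← ENNReal.ofReal_rpow_of_nonneg v.coe_nonneg one_half_pos.le, ENNReal.ofReal_coe_nnreal,
      ← ENNReal.rpow_mul]
    congr 1
    ring
  rw [gaussianReal_zero_eq_map_sqrt_mul v, lintegral_map (by fun_prop) (by fun_prop)]
  simp only [enorm_mul, ENNReal.mul_rpow_of_nonneg _ _ hp, hsqrt]
  exact lintegral_const_mul _ (by fun_prop)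

end Gaussian

section AlmostSureConvergence

variable {α : Type*} [MeasurableSpace α] {P : Measure α}

lemma measure_exists_ge_le {A : ℕ → Set α} {m : ℕ} {c : ℝ≥0∞}
    (h : ∀ N, P {ω | ∃ k ∈ Finset.Icc m N, ω ∈ A k} ≤ c) : P {ω | ∃ k ≥ m, ω ∈ A k} ≤ c := by
  have hmono : Monotone fun N => {ω | ∃ k ∈ Finset.Icc m N, ω ∈ A k} :=
    fun N M hNM ω ⟨k, hk, hω⟩ => ⟨k, Finset.Icc_subset_Icc_right hNM hk, hω⟩
  have hsub : {ω | ∃ k ≥ m, ω ∈ A k} ⊆ ⋃ N, {ω | ∃ k ∈ Finset.Icc m N, ω ∈ A k} :=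
    fun ω ⟨k, hk, hω⟩ => Set.mem_iUnion.2 ⟨k, k, Finset.mem_Icc.2 ⟨hk, le_rfl⟩, hω⟩
  exact (measure_mono hsub).trans (le_of_tendsto' (tendsto_measure_iUnion_atTop hmono) h)

lemma tendsto_ofReal_const_mul_div_of_tendsto_zero {ι : Type*} {l : Filter ι} {f : ι → ℝ}
    (hf : Tendsto f l (𝓝 0)) (a b : ℝ) :
    Tendsto (fun i => ENNReal.ofReal (a * f i / b)) l (𝓝 0) := by
  simpa using ENNReal.tendsto_ofReal ((hf.const_mul a).div_const b)

lemma ae_tendsto_of_tendsto_measure_exists_ge {E : Type*} [PseudoMetricSpace E] {f : ℕ → α → E}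
    {g : α → E}
    (h : ∀ ε > 0, Tendsto (fun m => P {ω | ∃ k ≥ m, ε ≤ dist (f k ω) (g ω)}) atTop (𝓝 0)) :
    ∀ᵐ ω ∂P, Tendsto (fun k => f k ω) atTop (𝓝 (g ω)) := by
  have hev (ε : ℝ) (hε : 0 < ε) : ∀ᵐ ω ∂P, ∀ᶠ k in atTop, dist (f k ω) (g ω) < ε := by
    refine le_antisymm (ge_of_tendsto' (h ε hε) fun m => measure_mono fun ω hω => ?_) zero_le
    obtain ⟨k, hk, hkω⟩ := frequently_atTop.1 (not_eventually.1 hω) m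
    exact ⟨k, hk, not_lt.1 hkω⟩
  filter_upwards [ae_all_iff.2 fun n : ℕ => hev (1 / (n + 1)) Nat.one_div_pos_of_nat] with ω hω
  exact Metric.nhds_basis_ball_inv_nat_succ.tendsto_right_iff.2 fun n _ => hω n

end AlmostSureConvergence

namespace IsBrownianOn

variable {Ω : Type*} [MeasurableSpace Ω] {P : Measure Ω} {T : ℝ} {W : ℝ → Ω → ℝ}

lemma hasLaw_increment (hW : IsBrownianOn W T P) (π : TimePartition T) (i : Fin π.n) :
    HasLaw (fun ω => W (π.t (i + 1)) ω - W (π.t i) ω)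
      (gaussianReal 0 (π.t (i + 1) - π.t i).toNNReal) P :=
  hW.law_increments _ _ (π.t_mem_Icc i.2.le).1 (π.t_lt i i.2).le (π.t_mem_Icc i.2).2

lemma iIndepFun_increments (hW : IsBrownianOn W T P) (π : TimePartition T) :
    iIndepFun (fun (i : Fin π.n) ω => W (π.t (i + 1)) ω - W (π.t i) ω) P :=
  hW.indep_increments π.n (fun i => ⟨π.t i, π.t_mem_Icc (Nat.lt_succ_iff.1 i.2)⟩)
    fun _ j hij => π.t_le_t hij (Nat.lt_succ_iff.1 j.2)

lemma hasLaw_increments (hW : IsBrownianOn W T P) (π : TimePartition T) :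
    HasLaw (fun ω (i : Fin π.n) => W (π.t (i + 1)) ω - W (π.t i) ω)
      (Measure.pi fun i : Fin π.n => gaussianReal 0 (π.t (i + 1) - π.t i).toNNReal) P :=
  have := (hW.iIndepFun_increments π).isProbabilityMeasure
  (hW.iIndepFun_increments π).hasLaw_pi (hW.hasLaw_increment π)

lemma memLp_sq_increment (hW : IsBrownianOn W T P) (π : TimePartition T) (i : Fin π.n) :
    MemLp (fun ω => (W (π.t (i + 1)) ω - W (π.t i) ω) ^ 2) 2 P := by
  have hlaw := hW.hasLaw_increment π i
  have h4 : MemLp (fun ω => W (π.t (i + 1)) ω - W (π.t i) ω) 4 P :=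
    (memLp_map_measure_iff aestronglyMeasurable_id hlaw.aemeasurable).1
      (hlaw.map_eq ▸ memLp_id_gaussianReal' 4 (by norm_num))
  simpa only [sq] using h4.mul' h4

lemma memLp_quadSum (hW : IsBrownianOn W T P) (π : TimePartition T) :
    MemLp (fun ω => quadSum (fun t => W t ω) π) 2 P :=
  memLp_finsetSum _ fun i hi => hW.memLp_sq_increment π ⟨i, Finset.mem_range.1 hi⟩

lemma integral_pow_increment (hW : IsBrownianOn W T P) (π : TimePartition T) (i : Fin π.n)
    (r : ℕ) : ∫ ω, (W (π.t (i + 1)) ω - W (π.t i) ω) ^ r ∂P =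
      ∫ x, x ^ r ∂gaussianReal 0 (π.t (i + 1) - π.t i).toNNReal :=
  (hW.hasLaw_increment π i).integral_comp (f := fun x => x ^ r) (by fun_prop)

lemma integral_quadSum [IsProbabilityMeasure P] (hW : IsBrownianOn W T P) (π : TimePartition T) :
    ∫ ω, quadSum (fun t => W t ω) π ∂P = T := by
  simp only [quadSum, Finset.sum_range]
  have hmean (i : Fin π.n) :
      ∫ ω, (W (π.t (i + 1)) ω - W (π.t i) ω) ^ 2 ∂P = π.t (i + 1) - π.t i := by
    rw [hW.integral_pow_increment, integral_sq_gaussianReal_zero,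
      Real.coe_toNNReal _ (sub_nonneg.2 (π.t_lt i i.2).le)]
  rw [integral_finsetSum _ fun i _ => (hW.memLp_sq_increment π i).integrable one_le_two,
    Finset.sum_congr rfl fun i _ => hmean i, ← Finset.sum_range (fun i => π.t (i + 1) - π.t i),
    π.sum_sub]

lemma variance_sq_increment_le [IsProbabilityMeasure P] (hW : IsBrownianOn W T P)
    (π : TimePartition T) (i : Fin π.n) :
    Var[fun ω => (W (π.t (i + 1)) ω - W (π.t i) ω) ^ 2; P] ≤
      (∫ x, x ^ 4 ∂gaussianReal 0 1) * π.mesh * (π.t (i + 1) - π.t i) := by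
  have hsub : 0 ≤ π.t (i + 1) - π.t i := sub_nonneg.2 (π.t_lt i i.2).le
  have : 0 ≤ ∫ x, x ^ 4 ∂gaussianReal 0 1 := integral_nonneg fun x => by positivity
  calc Var[fun ω => (W (π.t (i + 1)) ω - W (π.t i) ω) ^ 2; P]
      ≤ ∫ ω, (W (π.t (i + 1)) ω - W (π.t i) ω) ^ 4 ∂P := by
        refine (variance_le_expectation_sq (hW.memLp_sq_increment π i).1).trans_eq ?_
        simp only [Pi.pow_apply, ← pow_mul]
    _ = (∫ x, x ^ 4 ∂gaussianReal 0 1) * (π.t (i + 1) - π.t i) * (π.t (i + 1) - π.t i) := by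
        rw [hW.integral_pow_increment, integral_pow_gaussianReal_zero, Real.coe_toNNReal _ hsub,
          show 4 = 2 * 2 by norm_num, pow_mul, Real.sq_sqrt hsub]
        ring
    _ ≤ (∫ x, x ^ 4 ∂gaussianReal 0 1) * π.mesh * (π.t (i + 1) - π.t i) := by
        gcongr
        exact π.sub_le_mesh i.2

lemma variance_quadSum_le [IsProbabilityMeasure P] (hW : IsBrownianOn W T P)
    (π : TimePartition T) :
    Var[fun ω => quadSum (fun t => W t ω) π; P] ≤
      (∫ x, x ^ 4 ∂gaussianReal 0 1) * T * π.mesh := by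
  have hsum : (fun ω => quadSum (fun t => W t ω) π) =
      ∑ i : Fin π.n, fun ω => (W (π.t (i + 1)) ω - W (π.t i) ω) ^ 2 := by
    ext ω
    rw [Finset.sum_apply, quadSum, Finset.sum_range]
  have hindep (i j : Fin π.n) (hij : i ≠ j) :
      IndepFun (fun ω => (W (π.t (i + 1)) ω - W (π.t i) ω) ^ 2)
        (fun ω => (W (π.t (j + 1)) ω - W (π.t j) ω) ^ 2) P :=
    ((hW.iIndepFun_increments π).indepFun hij).comp (φ := fun x : ℝ => x ^ 2)
      (ψ := fun x : ℝ => x ^ 2) (by fun_prop) (by fun_prop)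
  calc Var[fun ω => quadSum (fun t => W t ω) π; P]
      = ∑ i : Fin π.n, Var[fun ω => (W (π.t (i + 1)) ω - W (π.t i) ω) ^ 2; P] := by
        rw [hsum]
        exact IndepFun.variance_sum (fun i _ => hW.memLp_sq_increment π i)
          fun i _ j _ hij => hindep i j hij
    _ ≤ ∑ i : Fin π.n, (∫ x, x ^ 4 ∂gaussianReal 0 1) * π.mesh * (π.t (i + 1) - π.t i) :=
        Finset.sum_le_sum fun i _ => hW.variance_sq_increment_le π i
    _ = (∫ x, x ^ 4 ∂gaussianReal 0 1) * T * π.mesh := by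
        rw [← Finset.mul_sum, ← Finset.sum_range (fun i => π.t (i + 1) - π.t i), π.sum_sub]
        ring

theorem tendstoInMeasure_quadSum [IsProbabilityMeasure P] (hW : IsBrownianOn W T P) :
    TendstoInMeasure P (fun (π : TimePartition T) ω => quadSum (fun t => W t ω) π)
      (TimePartition.meshToZero T) fun _ => T := by
  rw [tendstoInMeasure_iff_dist]
  intro ε hε
  have hbound (π : TimePartition T) : P {ω | ε ≤ dist (quadSum (fun t => W t ω) π) T} ≤
      ENNReal.ofReal ((∫ x, x ^ 4 ∂gaussianReal 0 1) * T * π.mesh / ε ^ 2) := by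
    have hcheb := meas_ge_le_variance_div_sq (hW.memLp_quadSum π) hε
    rw [hW.integral_quadSum π] at hcheb
    refine hcheb.trans (ENNReal.ofReal_le_ofReal ?_)
    gcongr
    exact hW.variance_quadSum_le π
  exact tendsto_of_tendsto_of_tendsto_of_le_of_le tendsto_const_nhds
    (tendsto_ofReal_const_mul_div_of_tendsto_zero tendsto_comap _ _) (fun _ => zero_le) hbound

lemma sq_mul_measureReal_exists_quadSum_le [IsProbabilityMeasure P] (hW : IsBrownianOn W T P)
    {ρ : ℕ → TimePartition T} (hρ : Monotone fun k => (ρ k).points) {m N : ℕ} (hmN : m ≤ N)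
    {ε : ℝ} (hε : 0 ≤ ε) :
    ε ^ 2 * P.real {ω | ∃ k ∈ Finset.Icc m N, ε ≤ |quadSum (fun t => W t ω) (ρ k) - T|} ≤
      (∫ x, x ^ 4 ∂gaussianReal 0 1) * T * (ρ m).mesh := by
  set π := ρ N
  have hlaw := hW.hasLaw_increments π
  have hquad (k : ℕ) (hk : k ≤ N) (ω : Ω) :
      quadSum (stepPath π fun i => W (π.t (i + 1)) ω - W (π.t i) ω) (ρ k) =
        quadSum (fun t => W t ω) (ρ k) :=
    quadSum_stepPath_increments (hρ hk) fun t => W t ω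
  have hmeas (k : ℕ) : Measurable fun y => quadSum (stepPath π y) (ρ k) - T :=
    (measurable_quadSum_stepPath _ _).sub_const T
  have hset : MeasurableSet
      {y | ∃ k ∈ Finset.Icc m N, ε ≤ |quadSum (stepPath π y) (ρ k) - T|} :=
    measurableSet_setOfPred.2 <| Measurable.exists fun k => measurable_const.and <|
      measurableSet_setOfPred.1 <| measurableSet_le measurable_const (hmeas k).abs
  have hmax := MixedFBM.sq_mul_measureReal_exists_quadSum_le
    (μ := Measure.pi fun i : Fin π.n => gaussianReal 0 (π.t (i + 1) - π.t i).toNNReal)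
    (memLp_coordinate_pi fun _ => memLp_id_gaussianReal' 4 (by norm_num))
    (measurePreserving_reflectOn_pi fun _ =>
      ⟨measurable_neg, by rw [gaussianReal_map_neg, neg_zero]⟩) hρ m N T hε
  rw [← hlaw.measureReal_eq hset,
    ← hlaw.integral_comp ((hmeas m).pow_const 2).aestronglyMeasurable] at hmax
  have hevent : {ω | ∃ k ∈ Finset.Icc m N, ε ≤ |quadSum (fun t => W t ω) (ρ k) - T|} =
      {ω | ∃ k ∈ Finset.Icc m N,
        ε ≤ |quadSum (stepPath π fun i => W (π.t (i + 1)) ω - W (π.t i) ω) (ρ k) - T|} := by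
    ext ω
    exact exists_congr fun k => and_congr_right fun hk => by rw [hquad k (Finset.mem_Icc.1 hk).2]
  rw [hevent]
  refine hmax.trans ((le_of_eq ?_).trans (hW.variance_quadSum_le (ρ m)))
  rw [variance_eq_integral (hW.memLp_quadSum _).1.aemeasurable, hW.integral_quadSum]
  simp only [Function.comp_def, hquad m hmN]

/-- **Lévy's theorem.** -/
theorem ae_tendsto_quadSum [IsProbabilityMeasure P] (hW : IsBrownianOn W T P)
    {ρ : ℕ → TimePartition T} (hρ : TimePartition.IsNestedSeq ρ) :
    ∀ᵐ ω ∂P, Tendsto (fun k => quadSum (fun t => W t ω) (ρ k)) atTop (𝓝 T) := by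
  refine ae_tendsto_of_tendsto_measure_exists_ge fun ε hε => ?_
  have hbound (m : ℕ) : P {ω | ∃ k ≥ m, ε ≤ dist (quadSum (fun t => W t ω) (ρ k)) T} ≤
      ENNReal.ofReal ((∫ x, x ^ 4 ∂gaussianReal 0 1) * T * (ρ m).mesh / ε ^ 2) := by
    refine measure_exists_ge_le (A := fun k => {ω | ε ≤ dist (quadSum (fun t => W t ω) (ρ k)) T})
      fun N => ?_
    rcases lt_or_ge N m with hNm | hmN
    · simp [Finset.Icc_eq_empty_of_lt hNm]
    · rw [← ofReal_measureReal]
      refine ENNReal.ofReal_le_ofReal ?_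
      rw [le_div_iff₀' (by positivity)]
      exact hW.sq_mul_measureReal_exists_quadSum_le hρ.points_mono hmN hε.le
  exact tendsto_of_tendsto_of_tendsto_of_le_of_le tendsto_const_nhds
    (tendsto_ofReal_const_mul_div_of_tendsto_zero hρ.mesh_tendsto _ _) (fun _ => zero_le) hbound

end IsBrownianOn

section DyadicChaining

/-- The dyadic points of level `n` of the interval `[0, T]`, at which the chaining argument samples
a path. -/
def dyadicPoint (T : ℝ) (n k : ℕ) : ℝ := k * (T / 2 ^ n)

/-- The index of the last dyadic point of level `n` of `[0, T]` that is at most `t`, for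
`t ∈ [0, T]`. -/
def dyadicIndex (T : ℝ) (n : ℕ) (t : ℝ) : ℕ := ⌊t / (T / 2 ^ n)⌋₊

variable {T : ℝ}

lemma dyadicPoint_mem_Icc (hT : 0 ≤ T) {n k : ℕ} (hk : k ≤ 2 ^ n) :
    dyadicPoint T n k ∈ Set.Icc 0 T := by
  refine ⟨by rw [dyadicPoint]; positivity, ?_⟩
  have hk' : (k : ℝ) ≤ 2 ^ n := by exact_mod_cast hk
  calc (k : ℝ) * (T / 2 ^ n) ≤ 2 ^ n * (T / 2 ^ n) := by gcongr
    _ = T := mul_div_cancel₀ T (by positivity)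

lemma dyadicPoint_succ_two_mul (T : ℝ) (n k : ℕ) :
    dyadicPoint T (n + 1) (2 * k) = dyadicPoint T n k := by
  rw [dyadicPoint, dyadicPoint, pow_succ]
  push_cast
  field_simp

lemma dyadicPoint_succ_sub (T : ℝ) (n k : ℕ) :
    dyadicPoint T n (k + 1) - dyadicPoint T n k = T / 2 ^ n := by
  rw [dyadicPoint, dyadicPoint]
  push_cast
  ring

lemma dyadicIndex_succ_div_two (T : ℝ) (n : ℕ) (t : ℝ) :
    dyadicIndex T (n + 1) t / 2 = dyadicIndex T n t := by
  rw [dyadicIndex, dyadicIndex, ← Nat.floor_div_ofNat, pow_succ]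
  congr 1
  field_simp

lemma dyadicIndex_le_two_pow (hT : 0 < T) {t : ℝ} (ht : t ≤ T) (n : ℕ) :
    dyadicIndex T n t ≤ 2 ^ n := by
  refine Nat.floor_le_of_le ?_
  rw [div_le_iff₀ (by positivity)]
  push_cast
  rwa [mul_div_cancel₀ T (by positivity)]

lemma dyadicIndex_mono (hT : 0 ≤ T) (n : ℕ) : Monotone (dyadicIndex T n) := fun s t hst =>
  Nat.floor_mono (by gcongr)

lemma dyadicIndex_le_succ (hT : 0 < T) {n : ℕ} {s t : ℝ} (hs : 0 ≤ s)
    (hst : t - s ≤ T / 2 ^ n) : dyadicIndex T n t ≤ dyadicIndex T n s + 1 := by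
  rw [dyadicIndex, dyadicIndex, ← Nat.floor_add_one (by positivity)]
  refine Nat.floor_mono ?_
  rwa [← sub_le_iff_le_add', ← sub_div, div_le_one (by positivity)]

lemma tendsto_dyadicPoint_dyadicIndex (hT : 0 < T) {t : ℝ} (ht : 0 ≤ t) :
    Tendsto (fun n => dyadicPoint T n (dyadicIndex T n t)) atTop (𝓝 t) := by
  have hstep : Tendsto (fun n : ℕ => t - T / 2 ^ n) atTop (𝓝 t) := by
    simpa using tendsto_const_nhds.sub (tendsto_const_nhds.div_atTop
      (tendsto_pow_atTop_atTop_of_one_lt (one_lt_two (α := ℝ))))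
  refine tendsto_of_tendsto_of_tendsto_of_le_of_le hstep tendsto_const_nhds
    (fun n => ?_) fun n => ?_
  · have hlt := Nat.lt_floor_add_one (t / (T / 2 ^ n))
    rw [div_lt_iff₀ (by positivity), add_one_mul] at hlt
    exact sub_le_iff_le_add.2 hlt.le
  · exact (le_div_iff₀ (by positivity)).1 (Nat.floor_le (by positivity))

variable {E : Type*} [PseudoMetricSpace E] {K q : ℝ} {x : ℝ → E}

lemma dist_dyadicPoint_le {n : ℕ} (hKq : 0 ≤ K * q ^ n)
    (h : ∀ k < 2 ^ n, dist (x (dyadicPoint T n k)) (x (dyadicPoint T n (k + 1))) ≤ K * q ^ n)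
    {i j : ℕ} (hij : i ≤ j) (hji : j ≤ i + 1) (hj : j ≤ 2 ^ n) :
    dist (x (dyadicPoint T n i)) (x (dyadicPoint T n j)) ≤ K * q ^ n := by
  obtain rfl | rfl : j = i ∨ j = i + 1 := by omega
  · rwa [dist_self]
  · exact h i hj

lemma dist_dyadicPoint_dyadicIndex_le (hT : 0 < T) (hx : ContinuousOn x (Set.Icc 0 T))
    (hK : 0 ≤ K) (hq0 : 0 ≤ q) (hq1 : q < 1)
    (h : ∀ n, ∀ k < 2 ^ n,
      dist (x (dyadicPoint T n k)) (x (dyadicPoint T n (k + 1))) ≤ K * q ^ n)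
    {t : ℝ} (ht : t ∈ Set.Icc 0 T) (n : ℕ) :
    dist (x (dyadicPoint T n (dyadicIndex T n t))) (x t) ≤ K * q ^ n / (1 - q) := by
  have hstep (n : ℕ) : dist (x (dyadicPoint T n (dyadicIndex T n t)))
      (x (dyadicPoint T (n + 1) (dyadicIndex T (n + 1) t))) ≤ K * q ^ n := by
    have hindex := dyadicIndex_succ_div_two T n t
    rw [← dyadicPoint_succ_two_mul]
    refine (dist_dyadicPoint_le (by positivity) (h (n + 1)) (by omega) (by omega)
      (dyadicIndex_le_two_pow hT ht.2 _)).trans ?_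
    exact mul_le_mul_of_nonneg_left (pow_le_pow_of_le_one hq0 hq1.le n.le_succ) hK
  have hlim : Tendsto (fun n => x (dyadicPoint T n (dyadicIndex T n t))) atTop (𝓝 (x t)) :=
    (hx t ht).tendsto.comp (tendsto_nhdsWithin_iff.2
      ⟨tendsto_dyadicPoint_dyadicIndex hT ht.1, Eventually.of_forall fun n =>
        dyadicPoint_mem_Icc hT.le (dyadicIndex_le_two_pow hT ht.2 n)⟩)
  exact dist_le_of_le_geometric_of_tendsto q K hq1 hstep hlim n

lemma dist_le_of_dist_dyadicPoint_le (hT : 0 < T) (hx : ContinuousOn x (Set.Icc 0 T))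
    (hK : 0 ≤ K) (hq0 : 0 ≤ q) (hq1 : q < 1)
    (h : ∀ n, ∀ k < 2 ^ n,
      dist (x (dyadicPoint T n k)) (x (dyadicPoint T n (k + 1))) ≤ K * q ^ n)
    {s t : ℝ} (hs : 0 ≤ s) (hst : s ≤ t) (ht : t ≤ T) {n : ℕ} (hn : t - s ≤ T / 2 ^ n) :
    dist (x s) (x t) ≤ K * (1 + 2 / (1 - q)) * q ^ n := by
  set i := dyadicIndex T n s
  set j := dyadicIndex T n t
  calc dist (x s) (x t)
      ≤ dist (x s) (x (dyadicPoint T n i)) +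
          dist (x (dyadicPoint T n i)) (x (dyadicPoint T n j)) +
          dist (x (dyadicPoint T n j)) (x t) := dist_triangle4 _ _ _ _
    _ ≤ K * q ^ n / (1 - q) + K * q ^ n + K * q ^ n / (1 - q) := by
        refine add_le_add_three ?_ ?_ ?_
        · rw [dist_comm]
          exact dist_dyadicPoint_dyadicIndex_le hT hx hK hq0 hq1 h ⟨hs, hst.trans ht⟩ n
        · exact dist_dyadicPoint_le (by positivity) (h n) (dyadicIndex_mono hT.le n hst)
            (dyadicIndex_le_succ hT hs hn) (dyadicIndex_le_two_pow hT ht n)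
        · exact dist_dyadicPoint_dyadicIndex_le hT hx hK hq0 hq1 h ⟨hs.trans hst, ht⟩ n
    _ = K * (1 + 2 / (1 - q)) * q ^ n := by ring

lemma holderOnWith_of_dist_le {C γ : ℝ≥0} {A : Set ℝ}
    (h : ∀ s ∈ A, ∀ t ∈ A, s < t → dist (x s) (x t) ≤ C * (t - s) ^ (γ : ℝ)) :
    HolderOnWith C γ x A := by
  have hlt {s t : ℝ} (hs : s ∈ A) (ht : t ∈ A) (hst : s < t) :
      edist (x s) (x t) ≤ C * edist s t ^ (γ : ℝ) := by
    rw [edist_dist, edist_dist, dist_comm s t, Real.dist_eq, abs_of_pos (sub_pos.2 hst),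
      ENNReal.ofReal_rpow_of_nonneg (sub_nonneg.2 hst.le) γ.coe_nonneg, ← ENNReal.ofReal_coe_nnreal,
      ← ENNReal.ofReal_mul C.coe_nonneg]
    exact ENNReal.ofReal_le_ofReal (h s hs t ht hst)
  intro s hs t ht
  rcases lt_trichotomy s t with hst | rfl | hst
  · exact hlt hs ht hst
  · simp
  · rw [edist_comm, edist_comm s]
    exact hlt ht hs hst

lemma exists_holderOnWith_of_dist_dyadicPoint_le (hT : 0 < T)
    (hx : ContinuousOn x (Set.Icc 0 T)) (hK : 0 ≤ K) {γ : ℝ≥0} (hγ : 0 < γ)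
    (h : ∀ n, ∀ k < 2 ^ n, dist (x (dyadicPoint T n k)) (x (dyadicPoint T n (k + 1))) ≤
      K * ((1 / 2 : ℝ) ^ (γ : ℝ)) ^ n) :
    ∃ C, HolderOnWith C γ x (Set.Icc 0 T) := by
  set q : ℝ := (1 / 2 : ℝ) ^ (γ : ℝ) with hq
  have hq1 : q < 1 := Real.rpow_lt_one (by norm_num) (by norm_num) (by exact_mod_cast hγ)
  have : 0 < 1 - q := sub_pos.2 hq1
  set C : ℝ≥0 := (K * (1 + 2 / (1 - q)) * (2 / T) ^ (γ : ℝ)).toNNReal with hC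
  refine ⟨C, holderOnWith_of_dist_le fun s hs t ht hst => ?_⟩
  have hts : 0 < t - s := sub_pos.2 hst
  obtain ⟨n, hn1, hn2⟩ := exists_nat_pow_near_of_lt_one (x := (t - s) / T) (y := (1 / 2 : ℝ))
    (by positivity) (by rw [div_le_one hT]; linarith [hs.1, ht.2]) (by norm_num) (by norm_num)
  have hqn : q ^ n ≤ (2 / T) ^ (γ : ℝ) * (t - s) ^ (γ : ℝ) := by
    rw [hq, Real.rpow_pow_comm (by norm_num), ← Real.mul_rpow (by positivity) hts.le]
    refine Real.rpow_le_rpow (by positivity) ?_ γ.2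
    rw [pow_succ] at hn1
    linarith [show 2 / T * (t - s) = 2 * ((t - s) / T) by ring]
  have hn : t - s ≤ T / 2 ^ n := by
    rw [div_le_iff₀ hT, one_div_pow] at hn2
    exact hn2.trans_eq (by ring)
  calc dist (x s) (x t) ≤ K * (1 + 2 / (1 - q)) * q ^ n :=
        dist_le_of_dist_dyadicPoint_le hT hx hK (by positivity) hq1 h hs.1 hst.le ht.2 hn
    _ ≤ K * (1 + 2 / (1 - q)) * ((2 / T) ^ (γ : ℝ) * (t - s) ^ (γ : ℝ)) := by gcongr
    _ = C * (t - s) ^ (γ : ℝ) := by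
      rw [hC, Real.coe_toNNReal _ (by positivity), mul_assoc _ (_ ^ _)]

end DyadicChaining

section KolmogorovChentsov

variable {E Ω : Type*} [MeasurableSpace Ω] [PseudoMetricSpace E] {P : Measure Ω} {T p q : ℝ}
  {M : ℝ≥0} {X : ℝ → Ω → E}

lemma lintegral_edist_dyadicPoint_rpow_le (hT : 0 ≤ T)
    (hX : IsAEKolmogorovProcess (fun t : Set.Icc 0 T => X t) P p q M) {n k : ℕ} (hk : k < 2 ^ n) :
    ∫⁻ ω, edist (X (dyadicPoint T n k) ω) (X (dyadicPoint T n (k + 1)) ω) ^ p ∂P ≤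
      M * ENNReal.ofReal T ^ q * ((2 : ℝ≥0∞) ^ (-q)) ^ n := by
  have hedist : edist (dyadicPoint T n k) (dyadicPoint T n (k + 1)) =
      ENNReal.ofReal T * (2⁻¹) ^ n := by
    rw [edist_dist, dist_comm, Real.dist_eq, dyadicPoint_succ_sub, abs_of_nonneg (by positivity),
      div_eq_mul_inv, ENNReal.ofReal_mul hT, ← inv_pow, ENNReal.ofReal_pow (by norm_num),
      ENNReal.ofReal_inv_of_pos two_pos, ENNReal.ofReal_ofNat]
  refine (hX.kolmogorovCondition ⟨_, dyadicPoint_mem_Icc hT hk.le⟩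
    ⟨_, dyadicPoint_mem_Icc hT hk⟩).trans_eq ?_
  rw [Subtype.edist_mk_mk, hedist, ENNReal.mul_rpow_of_nonneg _ _ hX.q_pos.le, mul_assoc,
    ENNReal.rpow_neg, ← ENNReal.inv_rpow, ← ENNReal.rpow_natCast, ← ENNReal.rpow_natCast,
    ← ENNReal.rpow_mul, ← ENNReal.rpow_mul, mul_comm q]

/-- The weighted sum of the `p`-th powers of all dyadic increments of the path `x` on `[0, T]`; if
it is finite, then the increments of level `n` are `O(2 ^ (-γ n))`. -/
def dyadicEnergy (T γ p : ℝ) (x : ℝ → E) : ℝ≥0∞ :=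
  ∑' n : ℕ, ∑ k ∈ Finset.range (2 ^ n),
    (((2 : ℝ≥0∞) ^ γ) ^ n * edist (x (dyadicPoint T n k)) (x (dyadicPoint T n (k + 1)))) ^ p

lemma exists_dist_dyadicPoint_le {γ : ℝ} (hp : 0 < p) {x : ℝ → E}
    (hx : dyadicEnergy T γ p x ≠ ∞) :
    ∃ K, 0 ≤ K ∧ ∀ n, ∀ k < 2 ^ n,
      dist (x (dyadicPoint T n k)) (x (dyadicPoint T n (k + 1))) ≤
        K * ((1 / 2 : ℝ) ^ γ) ^ n := by
  set S := dyadicEnergy T γ p x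
  have hS : S ^ p⁻¹ ≠ ∞ := ENNReal.rpow_ne_top_of_nonneg (by positivity) hx
  refine ⟨(S ^ p⁻¹).toReal, ENNReal.toReal_nonneg, fun n k hk => ?_⟩
  have hterm : (((2 : ℝ≥0∞) ^ γ) ^ n *
      edist (x (dyadicPoint T n k)) (x (dyadicPoint T n (k + 1)))) ^ p ≤ S :=
    (Finset.single_le_sum (f := fun k => (((2 : ℝ≥0∞) ^ γ) ^ n *
      edist (x (dyadicPoint T n k)) (x (dyadicPoint T n (k + 1)))) ^ p)
      (fun _ _ => zero_le) (Finset.mem_range.2 hk)).trans (ENNReal.le_tsum n)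
  have hreal := ENNReal.toReal_mono hS ((ENNReal.le_rpow_inv_iff hp).2 hterm)
  rw [ENNReal.toReal_mul, ENNReal.toReal_pow, ← ENNReal.toReal_rpow, ENNReal.toReal_ofNat,
    ← dist_edist] at hreal
  rwa [one_div, Real.inv_rpow zero_le_two, inv_pow, ← div_eq_mul_inv,
    le_div_iff₀' (by positivity)]

lemma aemeasurable_edist_dyadicPoint (hT : 0 ≤ T)
    (hX : IsAEKolmogorovProcess (fun t : Set.Icc 0 T => X t) P p q M) {n k : ℕ} (hk : k < 2 ^ n) :
    AEMeasurable
      (fun ω => edist (X (dyadicPoint T n k) ω) (X (dyadicPoint T n (k + 1)) ω)) P :=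
  hX.aemeasurable_edist (s := ⟨_, dyadicPoint_mem_Icc hT hk.le⟩)
    (t := ⟨_, dyadicPoint_mem_Icc hT hk⟩)

lemma aemeasurable_dyadicEnergy_level (hT : 0 ≤ T)
    (hX : IsAEKolmogorovProcess (fun t : Set.Icc 0 T => X t) P p q M) (γ : ℝ) (n : ℕ) :
    AEMeasurable (fun ω => ∑ k ∈ Finset.range (2 ^ n), (((2 : ℝ≥0∞) ^ γ) ^ n *
      edist (X (dyadicPoint T n k) ω) (X (dyadicPoint T n (k + 1)) ω)) ^ p) P :=
  Finset.aemeasurable_fun_sum _ fun _ hk =>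
    ((aemeasurable_edist_dyadicPoint hT hX (Finset.mem_range.1 hk)).const_mul _).pow_const p

lemma lintegral_dyadicEnergy_level_le (hT : 0 ≤ T)
    (hX : IsAEKolmogorovProcess (fun t : Set.Icc 0 T => X t) P p q M) (γ : ℝ) (n : ℕ) :
    ∫⁻ ω, ∑ k ∈ Finset.range (2 ^ n), (((2 : ℝ≥0∞) ^ γ) ^ n *
      edist (X (dyadicPoint T n k) ω) (X (dyadicPoint T n (k + 1)) ω)) ^ p ∂P ≤
      M * ENNReal.ofReal T ^ q * ((2 : ℝ≥0∞) ^ (γ * p + 1 - q)) ^ n := by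
  have hmeas {k : ℕ} (hk : k ∈ Finset.range (2 ^ n)) :=
    aemeasurable_edist_dyadicPoint hT hX (Finset.mem_range.1 hk)
  have hpow : (((2 : ℝ≥0∞) ^ γ) ^ n) ^ p = ((2 : ℝ≥0∞) ^ (γ * p)) ^ n := by
    rw [ENNReal.rpow_mul, ← ENNReal.rpow_natCast, ← ENNReal.rpow_natCast, ← ENNReal.rpow_mul,
      ← ENNReal.rpow_mul _ p, mul_comm p]
  have hratio : (2 : ℝ≥0∞) ^ (γ * p + 1 - q) = 2 * 2 ^ (γ * p) * 2 ^ (-q) := by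
    rw [sub_eq_add_neg, ENNReal.rpow_add _ _ two_ne_zero ENNReal.ofNat_ne_top,
      ENNReal.rpow_add _ _ two_ne_zero ENNReal.ofNat_ne_top, ENNReal.rpow_one, mul_comm 2]
  simp only [ENNReal.mul_rpow_of_nonneg _ _ hX.p_pos.le, hpow]
  rw [lintegral_finsetSum' _ fun k hk => ((hmeas hk).pow_const p).const_mul _]
  calc ∑ k ∈ Finset.range (2 ^ n), ∫⁻ ω, ((2 : ℝ≥0∞) ^ (γ * p)) ^ n *
        edist (X (dyadicPoint T n k) ω) (X (dyadicPoint T n (k + 1)) ω) ^ p ∂P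
      ≤ ∑ _k ∈ Finset.range (2 ^ n), ((2 : ℝ≥0∞) ^ (γ * p)) ^ n *
          (M * ENNReal.ofReal T ^ q * ((2 : ℝ≥0∞) ^ (-q)) ^ n) := by
        refine Finset.sum_le_sum fun k hk => ?_
        rw [lintegral_const_mul'' _ ((hmeas hk).pow_const p)]
        gcongr
        exact lintegral_edist_dyadicPoint_rpow_le hT hX (Finset.mem_range.1 hk)
    _ = M * ENNReal.ofReal T ^ q * ((2 : ℝ≥0∞) ^ (γ * p + 1 - q)) ^ n := by
        rw [Finset.sum_const, Finset.card_range, nsmul_eq_mul, hratio, mul_pow, mul_pow]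
        push_cast
        ring

lemma lintegral_dyadicEnergy_lt_top (hT : 0 ≤ T)
    (hX : IsAEKolmogorovProcess (fun t : Set.Icc 0 T => X t) P p q M) {γ : ℝ}
    (hγ : γ * p + 1 < q) : ∫⁻ ω, dyadicEnergy T γ p (fun t => X t ω) ∂P < ∞ := by
  have hratio : (2 : ℝ≥0∞) ^ (γ * p + 1 - q) < 1 :=
    ENNReal.rpow_lt_one_of_one_lt_of_neg ENNReal.one_lt_two (sub_neg.2 hγ)
  simp only [dyadicEnergy]
  rw [lintegral_tsum (aemeasurable_dyadicEnergy_level hT hX γ)]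
  refine (ENNReal.tsum_le_tsum (lintegral_dyadicEnergy_level_le hT hX γ)).trans_lt ?_
  rw [ENNReal.tsum_mul_left, ENNReal.tsum_geometric]
  have hT' : ENNReal.ofReal T ^ q ≠ ∞ :=
    ENNReal.rpow_ne_top_of_nonneg hX.q_pos.le ENNReal.ofReal_ne_top
  exact (ENNReal.mul_ne_top (ENNReal.mul_ne_top ENNReal.coe_ne_top hT')
    (ENNReal.inv_ne_top.2 (tsub_pos_of_lt hratio).ne')).lt_top

/-- **The Kolmogorov–Chentsov theorem** for a continuous process. -/
theorem ae_exists_holderOnWith_of_isAEKolmogorovProcess (hT : 0 < T)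
    (hX : IsAEKolmogorovProcess (fun t : Set.Icc 0 T => X t) P p q M)
    (hcont : ∀ᵐ ω ∂P, ContinuousOn (fun t => X t ω) (Set.Icc 0 T)) {γ : ℝ≥0} (hγ : 0 < γ)
    (hγp : γ * p + 1 < q) : ∀ᵐ ω ∂P, ∃ C, HolderOnWith C γ (fun t => X t ω) (Set.Icc 0 T) := by
  have hmeas : AEMeasurable (fun ω => dyadicEnergy T γ p fun t => X t ω) P :=
    AEMeasurable.tsum (aemeasurable_dyadicEnergy_level hT.le hX γ)
  filter_upwards [hcont, ae_lt_top' hmeas (lintegral_dyadicEnergy_lt_top hT.le hX hγp).ne]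
    with ω hω henergy
  obtain ⟨K, hK, hdist⟩ := exists_dist_dyadicPoint_le hX.p_pos henergy.ne
  exact exists_holderOnWith_of_dist_dyadicPoint_le hT hω hK hγ hdist

end KolmogorovChentsov

namespace IsFractionalBrownianOn

variable {Ω : Type*} [MeasurableSpace Ω] {P : Measure Ω} {H T : ℝ} {B : ℝ → Ω → ℝ}

lemma memLp_two (hB : IsFractionalBrownianOn B H T P) {t : ℝ} (ht : t ∈ Set.Icc 0 T) :
    MemLp (B t) 2 P :=
  (hB.gaussian.hasGaussianLaw_eval ⟨t, ht⟩).memLp_two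

lemma variance_eq (hB : IsFractionalBrownianOn B H T P) (hH : 0 < H) {t : ℝ}
    (ht : t ∈ Set.Icc 0 T) : Var[B t; P] = t ^ (2 * H) := by
  rw [← covariance_self (hB.memLp_two ht).aemeasurable, hB.covariance t ht t ht, sub_self,
    abs_zero, Real.zero_rpow (by positivity)]
  ring

variable [IsProbabilityMeasure P]

lemma hasLaw_sub (hB : IsFractionalBrownianOn B H T P) (hH : 0 < H) {s t : ℝ}
    (hs : s ∈ Set.Icc 0 T) (ht : t ∈ Set.Icc 0 T) :
    HasLaw (fun ω => B s ω - B t ω) (gaussianReal 0 (|s - t| ^ (2 * H)).toNNReal) P := by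
  have hgauss : HasGaussianLaw (fun ω => B s ω - B t ω) P :=
    hB.gaussian.hasGaussianLaw_fun_sub (s := ⟨s, hs⟩) (t := ⟨t, ht⟩)
  have hmean : ∫ ω, (B s ω - B t ω) ∂P = 0 := by
    rw [integral_sub ((hB.memLp_two hs).integrable one_le_two)
      ((hB.memLp_two ht).integrable one_le_two), hB.mean s hs, hB.mean t ht, sub_zero]
  have hvar : Var[fun ω => B s ω - B t ω; P] = |s - t| ^ (2 * H) := by
    have h := variance_sub (hB.memLp_two hs) (hB.memLp_two ht)
    rw [hB.variance_eq hH hs, hB.variance_eq hH ht, hB.covariance s hs t ht,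
      abs_sub_comm t s] at h
    exact h.trans (by ring)
  exact ⟨hgauss.aemeasurable, by rw [hgauss.map_eq_gaussianReal, hmean, hvar]⟩

lemma isAEKolmogorovProcess (hB : IsFractionalBrownianOn B H T P) (hH : 0 < H) {p : ℝ}
    (hp : 0 < p) : ∃ M, IsAEKolmogorovProcess (fun t : Set.Icc 0 T => B t) P p (H * p) M := by
  have hmoment : ∫⁻ x, ‖x‖ₑ ^ p ∂gaussianReal 0 1 ≠ ∞ := by
    have h := lintegral_rpow_enorm_lt_top_of_eLpNorm_lt_top (μ := gaussianReal 0 1) (f := id)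
      (p := p.toNNReal) (by simpa using hp) ENNReal.coe_ne_top
      (memLp_id_gaussianReal' (p.toNNReal : ℝ≥0∞) ENNReal.coe_ne_top).2
    simpa [hp.le] using h.ne
  have hmeas (t : Set.Icc 0 T) : AEMeasurable (B t) P := (hB.memLp_two t.2).aemeasurable
  refine ⟨_, fun t => (hmeas t).mk, .mk_of_secondCountableTopology
    (M := (∫⁻ x, ‖x‖ₑ ^ p ∂gaussianReal 0 1).toNNReal) (fun t => (hmeas t).measurable_mk)
    (fun s t => le_of_eq ?_) hp (by positivity), fun t => (hmeas t).ae_eq_mk⟩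
  calc ∫⁻ ω, edist ((hmeas s).mk _ ω) ((hmeas t).mk _ ω) ^ p ∂P
      = ∫⁻ ω, ‖B s ω - B t ω‖ₑ ^ p ∂P := by
        refine lintegral_congr_ae ?_
        filter_upwards [(hmeas s).ae_eq_mk, (hmeas t).ae_eq_mk] with ω hs ht
        rw [← hs, ← ht, edist_eq_enorm_sub]
    _ = ∫⁻ x, ‖x‖ₑ ^ p ∂gaussianReal 0 (|(s : ℝ) - t| ^ (2 * H)).toNNReal :=
        (hB.hasLaw_sub hH s.2 t.2).lintegral_comp (f := fun x => ‖x‖ₑ ^ p) (by fun_prop)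
    _ = (∫⁻ x, ‖x‖ₑ ^ p ∂gaussianReal 0 1).toNNReal * edist s t ^ (H * p) := by
        rw [lintegral_enorm_rpow_gaussianReal_zero _ hp.le, ENNReal.coe_toNNReal hmoment, mul_comm]
        congr 1
        rw [Subtype.edist_eq, edist_dist, Real.dist_eq, ← ENNReal.ofReal,
          ← ENNReal.ofReal_rpow_of_nonneg (abs_nonneg _) (by positivity), ← ENNReal.rpow_mul]
        congr 1
        ring

theorem ae_exists_holderOnWith (hB : IsFractionalBrownianOn B H T P) (hT : 0 < T) {γ : ℝ≥0}
    (hγ : 0 < γ) (hγH : γ < H) :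
    ∀ᵐ ω ∂P, ∃ C, HolderOnWith C γ (fun t => B t ω) (Set.Icc 0 T) := by
  have hH : 0 < H := γ.coe_nonneg.trans_lt hγH
  have hp : 0 < 2 / (H - γ) := div_pos two_pos (sub_pos.2 hγH)
  obtain ⟨M, hM⟩ := hB.isAEKolmogorovProcess hH hp
  refine ae_exists_holderOnWith_of_isAEKolmogorovProcess hT hM hB.cont hγ ?_
  have : (H - γ) * (2 / (H - γ)) = 2 := mul_div_cancel₀ 2 (sub_pos.2 hγH).ne'
  linarith

theorem ae_tendsto_quadSum (hB : IsFractionalBrownianOn B H T P) (hT : 0 < T) (hH : 1 / 2 < H) :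
    ∀ᵐ ω ∂P, Tendsto (quadSum fun t => B t ω) (TimePartition.meshToZero T) (𝓝 0) := by
  obtain ⟨γ, hγ, hγH⟩ := exists_between (Real.lt_toNNReal_iff_coe_lt.2 (by simpa using hH) :
    (1 / 2 : ℝ≥0) < H.toNNReal)
  filter_upwards [hB.ae_exists_holderOnWith hT (one_half_pos.trans hγ)
    (Real.lt_toNNReal_iff_coe_lt.1 hγH)] with ω ⟨_, hω⟩
  exact tendsto_quadSum_of_holderOnWith hγ hω

end IsFractionalBrownianOn

section ZeroQuadraticVariation

lemma tendstoInMeasure_of_forall_seq_exists_ae_tendsto {α ι E : Type*} [MeasurableSpace α]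
    [PseudoMetricSpace E] {μ : Measure α} [IsFiniteMeasure μ] {l : Filter ι}
    [l.IsCountablyGenerated] {f : ι → α → E} {g : α → E}
    (hf : ∀ i, AEStronglyMeasurable (f i) μ)
    (h : ∀ u : ℕ → ι, Tendsto u atTop l →
      ∃ φ : ℕ → ℕ, ∀ᵐ ω ∂μ, Tendsto (fun k => f (u (φ k)) ω) atTop (𝓝 (g ω))) :
    TendstoInMeasure μ f l g := by
  intro ε hε
  refine tendsto_of_subseq_tendsto fun u hu => ?_
  obtain ⟨φ, hφ⟩ := h u hu
  exact ⟨φ, tendstoInMeasure_of_tendsto_ae (fun k => hf (u (φ k))) hφ ε hε⟩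

instance (T : ℝ) : (TimePartition.meshToZero T).IsCountablyGenerated :=
  inferInstanceAs (comap _ _).IsCountablyGenerated

variable {Ω : Type*} [MeasurableSpace Ω] {P : Measure Ω} {T : ℝ} {W Z : ℝ → Ω → ℝ}

lemma IsBrownianOn.aemeasurable_quadSum_add (hW : IsBrownianOn W T P)
    (hZ : ∀ t ∈ Set.Icc 0 T, AEMeasurable (Z t) P) (π : TimePartition T) :
    AEMeasurable (fun ω => quadSum (fun t => W t ω + Z t ω) π) P := by
  refine Finset.aemeasurable_fun_sum _ fun i hi => AEMeasurable.pow_const ?_ 2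
  have hi := Finset.mem_range.1 hi
  have hincr := ((hW.hasLaw_increment π ⟨i, hi⟩).aemeasurable.add
    ((hZ _ (π.t_mem_Icc hi)).sub (hZ _ (π.t_mem_Icc hi.le))))
  exact hincr.congr (ae_of_all _ fun ω => (add_sub_add_comm _ _ _ _).symm)

theorem IsBrownianOn.isQuadraticVariation_add [IsProbabilityMeasure P] (hW : IsBrownianOn W T P)
    (hZ : ∀ t ∈ Set.Icc 0 T, AEMeasurable (Z t) P)
    (hZ0 : ∀ᵐ ω ∂P, Tendsto (quadSum fun t => Z t ω) (TimePartition.meshToZero T) (𝓝 0)) :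
    IsQuadraticVariation (fun t ω => W t ω + Z t ω) T P fun _ => T := by
  refine tendstoInMeasure_of_forall_seq_exists_ae_tendsto
    (fun π => (hW.aemeasurable_quadSum_add hZ π).aestronglyMeasurable) fun π hπ => ?_
  obtain ⟨φ, hφ, hWφ⟩ := (hW.tendstoInMeasure_quadSum.comp hπ).exists_seq_tendsto_ae
  refine ⟨φ, ?_⟩
  filter_upwards [hWφ, hZ0] with ω hWω hZω
  exact tendsto_quadSum_add hWω (hZω.comp (hπ.comp hφ.tendsto_atTop))

theorem IsBrownianOn.ae_tendsto_quadSum_add [IsProbabilityMeasure P] (hW : IsBrownianOn W T P)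
    (hZ0 : ∀ᵐ ω ∂P, Tendsto (quadSum fun t => Z t ω) (TimePartition.meshToZero T) (𝓝 0))
    {ρ : ℕ → TimePartition T} (hρ : TimePartition.IsNestedSeq ρ) :
    ∀ᵐ ω ∂P, Tendsto (fun k => quadSum (fun t => W t ω + Z t ω) (ρ k)) atTop (𝓝 T) := by
  filter_upwards [hW.ae_tendsto_quadSum hρ, hZ0] with ω hWω hZω
  exact tendsto_quadSum_add hWω (hZω.comp (tendsto_comap_iff.2 hρ.mesh_tendsto))

end ZeroQuadraticVariation

end MixedFBM

end

theorem lemma2p2_general {Ω : Type*} [MeasurableSpace Ω] (P : Measure Ω) [IsProbabilityMeasure P]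
    (T : ℝ) (hT : 0 ≤ T) (W Z X : ℝ → Ω → ℝ)
    (hW : MixedFBM.IsBrownianOn W T P)
    (hZ : ∀ t ∈ Set.Icc (0 : ℝ) T, AEMeasurable (Z t) P)
    (hZcont : ∀ᵐ ω ∂P, ContinuousOn (fun t => Z t ω) (Set.Icc 0 T))
    (hZquad : ∀ᵐ ω ∂P,
      Tendsto (MixedFBM.quadSum fun t => Z t ω) (MixedFBM.TimePartition.meshToZero T) (𝓝 0))
    (hX : ∀ t ∈ Set.Icc (0 : ℝ) T, ∀ ω, X t ω = W t ω + Z t ω) :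
    ∃ V : Ω → ℝ, MixedFBM.IsQuadraticVariation X T P V ∧
      ∃ J : ℝ → Ω → ℂ,
        (∀ ρ : ℕ → MixedFBM.TimePartition T, MixedFBM.TimePartition.IsNestedSeq ρ →
          ∀ᵐ ω ∂P,
            Tendsto (fun k => MixedFBM.quadSum (fun t => X t ω) (ρ k)) atTop (𝓝 (V ω)) ∧
            ∀ lam : ℝ, Tendsto (fun k => MixedFBM.iteratedSum (fun t => X t ω) lam (ρ k))
              atTop (𝓝 (J lam ω))) ∧
        ∀ᵐ ω ∂P, ∀ lam : ℝ,
          MixedFBM.periodogram (fun t => X t ω) T lam = V ω + 2 * (J lam ω).re := by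
  have hXeq (ω : Ω) : Set.EqOn (fun t => X t ω) (fun t => W t ω + Z t ω) (Set.Icc 0 T) :=
    fun t ht => hX t ht ω
  have hquad (ω : Ω) : MixedFBM.quadSum (T := T) (fun t => X t ω) =
      MixedFBM.quadSum fun t => W t ω + Z t ω :=
    funext (MixedFBM.quadSum_congr (hXeq ω))
  have hXcont : ∀ᵐ ω ∂P, ContinuousOn (fun t => X t ω) (Set.Icc 0 T) := by
    filter_upwards [hW.cont, hZcont] with ω hWω hZω using (hWω.add hZω).congr (hXeq ω)
  refine ⟨fun _ => T, ?_, fun lam ω => MixedFBM.iteratedIntegral (fun t => X t ω) T T lam,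
    fun ρ hρ => ?_, ?_⟩
  · simpa only [MixedFBM.IsQuadraticVariation, hquad] using hW.isQuadraticVariation_add hZ hZquad
  · filter_upwards [hXcont, hW.ae_tendsto_quadSum_add hZquad hρ] with ω hω hV
    rw [← hquad] at hV
    exact ⟨hV, MixedFBM.tendsto_iteratedSum hT hω (tendsto_comap_iff.2 hρ.mesh_tendsto) hV⟩
  · filter_upwards [hXcont] with ω hω using MixedFBM.periodogram_eq hT hω T

theorem lemma2p2 {Ω : Type*} [MeasurableSpace Ω] (P : Measure Ω) [IsProbabilityMeasure P]
    (T H : ℝ) (hT : 0 < T) (hH : H ∈ Set.Ioo (1 / 2 : ℝ) 1)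
    (W B X : ℝ → Ω → ℝ)
    (hW : MixedFBM.IsBrownianOn W T P)
    (hB : MixedFBM.IsFractionalBrownianOn B H T P)
    (hWB : IndepFun (fun ω (t : Set.Icc (0 : ℝ) T) => W t ω)
      (fun ω (t : Set.Icc (0 : ℝ) T) => B t ω) P)
    (hX : ∀ t ∈ Set.Icc (0 : ℝ) T, ∀ ω, X t ω = W t ω + B t ω) :
    ∃ V : Ω → ℝ, MixedFBM.IsQuadraticVariation X T P V ∧
      ∃ J : ℝ → Ω → ℂ,
        (∀ ρ : ℕ → MixedFBM.TimePartition T, MixedFBM.TimePartition.IsNestedSeq ρ →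
          ∀ᵐ ω ∂P,
            Tendsto (fun k => MixedFBM.quadSum (fun t => X t ω) (ρ k)) atTop (𝓝 (V ω)) ∧
            ∀ lam : ℝ, Tendsto (fun k => MixedFBM.iteratedSum (fun t => X t ω) lam (ρ k))
              atTop (𝓝 (J lam ω))) ∧
        ∀ᵐ ω ∂P, ∀ lam : ℝ,
          MixedFBM.periodogram (fun t => X t ω) T lam = V ω + 2 * (J lam ω).re :=
  lemma2p2_general P T hT.le W B X hW (fun _ ht => (hB.memLp_two ht).aemeasurable) hB.cont
    (hB.ae_tendsto_quadSum hT hH.1) hX
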